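/- Let $\Bbbk=\mathbb F_{3^6}$, let $\mathbb W=\mathbb W(\Bbbk)$ be its ring of $3$-typical Witt vectors, let $C_9=\langle\gamma\rangle$ be cyclic of order $9$ and let $C_3=\langle\gamma^3\rangle\subset C_9$. Let $$M=\mathbb W[x_0,\dots,x_8]/(x_0+x_3+x_6,\;x_1+x_4+x_7,\;x_2+x_5+x_8)$$ (that is, $M=\operatorname{Sym}(\operatorname{Ind}_{C_3}^{C_9}\bar\rho)$ with $\bar\rho$ the reduced regular representation of $C_3$ over $\mathbb W$), on which $C_9$ acts by $\mathbb W$-algebra automorphisms with $\gamma x_i=x_{i+1}$, indices modulo $9$. Put $$\Delta=x_0x_1\cdots x_8\in M^{C_9},\qquad I=(3,\;x_0-x_1,\;x_1-x_2,\;\dots,\;x_7-x_8)\subset M,$$ $$d_1=x_0x_3x_6,\quad d_2=x_1x_4x_7,\quad d_3=x_2x_5x_8\in M^{C_3},\qquad J=(d_1-d_2,\;d_1-d_3)\subset M^{C_3},$$ $$s_1=d_1+d_2+d_3,\qquad s_2=d_1d_2+d_2d_3+d_3d_1\in M^{C_9}.$$ Write $\hat H^q$ for Tate cohomology ($q\in\mathbb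 Z$) and $(-)^\wedge$ for adic completion. For $q\in\mathbb Z$ let $N^q=\hat H^q(C_3;M)$; this is a module over $M^{C_3}$ with a compatible action of $C_9/C_3$. Then for all integers $p\ge 0$ and all $q\in\mathbb Z$ there are isomorphisms of $M^{C_9}$-modules $$H^p\bigl(C_9/C_3;\hat H^q(C_3;(\Delta^{-1}M)^\wedge_I)\bigr)\;\cong\;H^p\bigl(C_9/C_3;(\Delta^{-1}N^q)^\wedge_J\bigr)\;\cong\;H^p\bigl(C_9/C_3;\Delta^{-1}N^q\bigr)^\wedge_{(s_1,s_2)},$$ the first compatible with the canonical maps from $H^p(C_9/C_3;N^q)$, the second with the canonical maps from $H^p(C_9/C_3;\Delta^{-1}N^q)$. -/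

import Mathlib

noncomputable section

open CategoryTheory

namespace SerreCompletion

/-! ### An element of a finite abelian group acts trivially on the Tate cohomology of the group -/

section TateTrivial
variable {S G : Type} [CommRing S] [CommGroup G]

theorem cochain_zero (X : Rep S G) (g : G) :
    ∃ s : (groupCohomology.inhomogeneousCochains X).X 1 ⟶
        (groupCohomology.inhomogeneousCochains X).X 0,
      (groupCohomology.cochainsMap (MonoidHom.id G) (X.applyAsHom g)).f 0 =
        𝟙 _ + (groupCohomology.inhomogeneousCochains X).d 0 1 ≫ s := by
  refine ⟨(groupCohomology.cochainsIso₁ X).hom ≫ ModuleCat.ofHom (LinearMap.proj g) ≫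
    (groupCohomology.cochainsIso₀ X).inv, ?_⟩
  rw [← Category.assoc _ (groupCohomology.cochainsIso₁ X).hom, ← groupCohomology.comp_d₀₁_eq,
    ← cancel_mono (groupCohomology.cochainsIso₀ X).hom]
  ext w
  simp [groupCohomology.cochainsIso₀]

theorem chain_zero (X : Rep S G) (g : G) :
    ∃ s : (groupHomology.inhomogeneousChains X).X 0 ⟶
        (groupHomology.inhomogeneousChains X).X 1,
      (groupHomology.chainsMap (MonoidHom.id G) (X.applyAsHom g)).f 0 =
        𝟙 _ + s ≫ (groupHomology.inhomogeneousChains X).d 1 0 := by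
  refine ⟨(groupHomology.chainsIso₀ X).hom ≫ ModuleCat.ofHom (Finsupp.lsingle g⁻¹) ≫
    (groupHomology.chainsIso₁ X).inv, ?_⟩
  rw [Category.assoc, Category.assoc, groupHomology.eq_d₁₀_comp_inv,
    ← cancel_mono (groupHomology.chainsIso₀ X).hom]
  ext w x
  simp [groupHomology.chainsIso₀, Unique.eq_default w]
  erw [groupHomology.d₁₀_single]
  simp
  rfl

variable [Fintype G]

theorem applyAsHom_zero (X : Rep S G) (g : G) :
    (tateCohomologyFunctor 0).map (X.applyAsHom g) = 𝟙 _ := by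
  change HomologicalComplex.homologyMap (tateComplex.map (X.applyAsHom g)) 0 = 𝟙 _
  have h : HomologicalComplex.cyclesMap (tateComplex.map (X.applyAsHom g)) 0 = 𝟙 _ := by
    rw [← cancel_mono ((tateComplex X).iCycles 0), HomologicalComplex.cyclesMap_i, Category.id_comp]
    obtain ⟨s, hs⟩ : ∃ s : (tateComplex X).X 1 ⟶ (tateComplex X).X 0,
        (tateComplex.map (X.applyAsHom g)).f 0 = 𝟙 ((tateComplex X).X 0) +
          (tateComplex X).d 0 1 ≫ s := cochain_zero X g
    rw [hs, Preadditive.comp_add, HomologicalComplex.iCycles_d_assoc]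
    simp
  rw [← cancel_epi ((tateComplex X).homologyπ 0), HomologicalComplex.homologyπ_naturality, h]
  simp

theorem applyAsHom_neg_one (X : Rep S G) (g : G) :
    (tateCohomologyFunctor (-1)).map (X.applyAsHom g) = 𝟙 _ := by
  change HomologicalComplex.homologyMap (tateComplex.map (X.applyAsHom g)) (-1) = 𝟙 _
  have h : HomologicalComplex.opcyclesMap (tateComplex.map (X.applyAsHom g)) (-1) = 𝟙 _ := by
    rw [← cancel_epi ((tateComplex X).pOpcycles (-1)), HomologicalComplex.p_opcyclesMap,
      Category.comp_id]
    obtain ⟨s, hs⟩ : ∃ s : (tateComplex X).X (-1) ⟶ (tateComplex X).X (-2),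
        (tateComplex.map (X.applyAsHom g)).f (-1) = 𝟙 ((tateComplex X).X (-1)) +
          s ≫ (tateComplex X).d (-2) (-1) := chain_zero X g
    rw [hs, Preadditive.add_comp, Category.assoc, HomologicalComplex.d_pOpcycles]
    simp
  rw [← cancel_mono ((tateComplex X).homologyι (-1)), HomologicalComplex.homologyι_naturality, h]
  simp

theorem isZero_coind (X : Rep S (⊥ : Subgroup G)) (n : ℕ) :
    Limits.IsZero ((tateCohomologyFunctor (R := S) (G := G) (n+1 : ℕ)).obj (Rep.coind (⊥ : Subgroup G).subtype X)) := by
  refine Limits.IsZero.of_iso ?_ (((TateCohomology.isoGroupCohomology (n+1)).app _) ≪≫ groupCohomology.coindIso (S := (⊥ : Subgroup G)) X (n+1))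
  exact isZero_groupCohomology_succ_of_subsingleton _ _

theorem isZero_ind (X : Rep S (⊥ : Subgroup G)) (n : ℕ) (m : ℤ) (hm : m = -((n+1 : ℕ) + 1 : ℤ)) :
    Limits.IsZero ((tateCohomologyFunctor (R := S) (G := G) m).obj (Rep.ind (⊥ : Subgroup G).subtype X)) := by
  classical
  refine Limits.IsZero.of_iso ?_ (((TateCohomology.isoGroupHomology m (n+1) hm).app _) ≪≫ groupHomology.indIso (⊥ : Subgroup G) X (n+1))
  exact isZero_groupHomology_succ_of_subsingleton _ _

theorem step_up (n : ℕ) (ih : ∀ (X : Rep S G) (g : G), (tateCohomologyFunctor (n:ℤ)).map (X.applyAsHom g) = 𝟙 _)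
    (X : Rep S G) (g : G) : (tateCohomologyFunctor ((n:ℤ)+1)).map (X.applyAsHom g) = 𝟙 _ := by
  let f := Rep.resCoindToHom (⊥ : Subgroup G).subtype X _ (𝟙 _)
  have : Mono f := by
    rw [Rep.mono_iff_injective]
    intro a b hab
    have := congrFun (congrArg Subtype.val hab) 1
    simpa [f, Rep.resCoindToHom] using this
  let C : ShortComplex (Rep S G) := ShortComplex.mk f (Limits.cokernel.π f) (by simp)
  have hC : C.ShortExact := { exact := ShortComplex.exact_cokernel f, mono_f := this, epi_g := inferInstanceAs (Epi (Limits.cokernel.π f)) }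
  let F : C ⟶ C := { τ₁ := C.X₁.applyAsHom g, τ₂ := C.X₂.applyAsHom g, τ₃ := C.X₃.applyAsHom g
                     comm₁₂ := Rep.applyAsHom_comm _ _
                     comm₂₃ := Rep.applyAsHom_comm _ _ }
  have hn := TateCohomology.δ_naturality hC hC F n
  have he : Epi (TateCohomology.δ hC n) :=
    (ShortComplex.exact_iff_epi _ ((isZero_coind _ n).eq_of_tgt _ _)).1 (TateCohomology.exact₁ hC n)
  change _ ≫ (tateCohomologyFunctor ((n:ℤ)+1)).map (X.applyAsHom g) = (tateCohomologyFunctor (n:ℤ)).map (C.X₃.applyAsHom g) ≫ _ at hn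
  rw [ih, Category.id_comp] at hn
  rw [← cancel_epi (TateCohomology.δ hC n), hn]
  exact (Category.comp_id _).symm

theorem step_down (n : ℕ) (m : ℤ) (hm : m = -((n+1 : ℕ) + 1 : ℤ)) 
   (ih : ∀ (X : Rep S G) (g : G), (tateCohomologyFunctor (m+1)).map (X.applyAsHom g) = 𝟙 _)
    (X : Rep S G) (g : G) : (tateCohomologyFunctor m).map (X.applyAsHom g) = 𝟙 _ := by
  let f := (Rep.indResHomEquiv (⊥ : Subgroup G).subtype (Rep.res (⊥ : Subgroup G).subtype X) X).symm (𝟙 _)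
  have : Epi f := by
    rw [Rep.epi_iff_surjective]
    intro a
    refine ⟨Representation.IndV.mk _ _ 1 a, ?_⟩
    simp [f]
  let C : ShortComplex (Rep S G) := ShortComplex.mk (Limits.kernel.ι f) f (by simp)
  have hC : C.ShortExact := { exact := ShortComplex.exact_kernel f, mono_f := inferInstanceAs (Mono (Limits.kernel.ι f)), epi_g := this }
  let F : C ⟶ C := { τ₁ := C.X₁.applyAsHom g, τ₂ := C.X₂.applyAsHom g, τ₃ := C.X₃.applyAsHom g
                     comm₁₂ := Rep.applyAsHom_comm _ _
                     comm₂₃ := Rep.applyAsHom_comm _ _ }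
  have hn := TateCohomology.δ_naturality hC hC F m
  have he : Mono (TateCohomology.δ hC m) :=
    (ShortComplex.exact_iff_mono _ ((isZero_ind _ n m hm).eq_of_src _ _)).1 (TateCohomology.exact₃ hC m)
  change _ ≫ (tateCohomologyFunctor (m+1)).map (C.X₁.applyAsHom g) = (tateCohomologyFunctor m).map (X.applyAsHom g) ≫ _ at hn
  rw [ih, Category.comp_id] at hn
  rw [← cancel_mono (TateCohomology.δ hC m), ← hn]
  exact (Category.id_comp _).symm

theorem map_applyAsHom (q : ℤ) (X : Rep S G) (g : G) :
    (tateCohomologyFunctor q).map (X.applyAsHom g) = 𝟙 _ := by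
  have up (n : ℕ) : ∀ (X : Rep S G) (g : G),
      (tateCohomologyFunctor (n : ℤ)).map (X.applyAsHom g) = 𝟙 _ := by
    induction n with
    | zero => exact applyAsHom_zero
    | succ n ih => exact step_up n ih
  have down (n : ℕ) : ∀ (X : Rep S G) (g : G),
      (tateCohomologyFunctor (-(n + 1 : ℤ))).map (X.applyAsHom g) = 𝟙 _ := by
    induction n with
    | zero => exact applyAsHom_neg_one
    | succ n ih =>
      refine step_down n _ rfl ?_
      have e : (-((n + 1 : ℕ) + 1 : ℤ) + 1) = -(n + 1 : ℤ) := by push_cast; ring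
      rw [e]
      exact ih
  rcases q with n | n
  · exact up n X g
  · rw [Int.negSucc_eq]; exact down n X g

end TateTrivial

/-! ### The action of the quotient group on Tate cohomology of a subgroup -/

section QuotientAction
variable {S G : Type} [CommRing S] [CommGroup G] (H : Subgroup G) [Fintype H]

/-- The map on `Ĥ^q(H; A)` induced by a morphism of `H`-representations, as a linear map. -/
def tateMap {S G : Type} [CommRing S] [Group G] [Fintype G] {A B : Rep S G} (q : ℤ) (f : A ⟶ B) :
    tateCohomology A q →ₗ[S] tateCohomology B q :=
  ((tateCohomologyFunctor q).map f).hom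

theorem tateMap_id {S G : Type} [CommRing S] [Group G] [Fintype G] (A : Rep S G) (q : ℤ) :
    tateMap q (𝟙 A) = LinearMap.id := by
  simp only [tateMap, CategoryTheory.Functor.map_id]; rfl

theorem tateMap_comp {S G : Type} [CommRing S] [Group G] [Fintype G] {A B C : Rep S G} (q : ℤ)
    (f : A ⟶ B) (g : B ⟶ C) : tateMap q (f ≫ g) = tateMap q g ∘ₗ tateMap q f := by
  simp only [tateMap, CategoryTheory.Functor.map_comp]; rfl

instance {S G : Type} [CommRing S] [Group G] [Fintype G] (q : ℤ) :
    (tateCohomologyFunctor (R := S) (G := G) q).Additive := by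
  unfold tateCohomologyFunctor; infer_instance

theorem tateMap_add {S G : Type} [CommRing S] [Group G] [Fintype G] {A B : Rep S G} (q : ℤ)
    (f g : A ⟶ B) : tateMap q (f + g) = tateMap q f + tateMap q g := by
  simp only [tateMap, CategoryTheory.Functor.map_add]; rfl

theorem tateMap_zero {S G : Type} [CommRing S] [Group G] [Fintype G] {A B : Rep S G} (q : ℤ) :
    tateMap q (0 : A ⟶ B) = 0 := by
  simp only [tateMap, CategoryTheory.Functor.map_zero]; rfl

theorem tateMap_smul {S G : Type} [CommRing S] [Group G] [Fintype G] {A B : Rep S G} (q : ℤ)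
    (s : S) (f : A ⟶ B) : tateMap q (s • f) = s • tateMap q f := by
  have h : tateComplex.map (s • f) = s • tateComplex.map f := by
    ext (i | i) : 1
    · rfl
    · ext1
      refine Finsupp.lhom_ext fun c a => ?_
      change (groupHomology.chainsMap (MonoidHom.id G) (s • f)).f i (Finsupp.single c a) =
        s • (groupHomology.chainsMap (MonoidHom.id G) f).f i (Finsupp.single c a)
      rw [groupHomology.chainsMap_f_single, groupHomology.chainsMap_f_single, Finsupp.smul_single]
      rfl
  change (HomologicalComplex.homologyMap (tateComplex.map (s • f)) q).hom = _
  rw [h]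
  exact congrArg ModuleCat.Hom.hom (ShortComplex.homologyMap_smul
    ((HomologicalComplex.shortComplexFunctor _ _ q).map (tateComplex.map f)) s)

/-- `G` acts on `Ĥ^q(H; A)` through the `H`-equivariant maps `a ↦ g a`
(conjugation on `H` is trivial because `G` is abelian). -/
def tateAction (A : Rep S G) (q : ℤ) :
    Representation S G (tateCohomology (Rep.res H.subtype A) q) where
  toFun g := tateMap q ((Rep.resFunctor H.subtype).map (A.applyAsHom g))
  map_one' := by
    have : A.applyAsHom 1 = 𝟙 A := by ext; simp
    rw [this, CategoryTheory.Functor.map_id, tateMap_id]; rfl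
  map_mul' g h := by
    have : A.applyAsHom (g * h) = A.applyAsHom h ≫ A.applyAsHom g := by ext; simp
    rw [this, CategoryTheory.Functor.map_comp, tateMap_comp]; rfl

instance (A : Rep S G) (q : ℤ) :
    Representation.IsTrivial ((tateAction H A q).comp H.subtype) where
  out h := by
    change tateMap q ((Rep.res H.subtype A).applyAsHom h) = _
    rw [tateMap, map_applyAsHom]; rfl

/-- `Ĥ^q(H; A)` as a representation of `G ⧸ H`. -/
def tateRep (A : Rep S G) (q : ℤ) : Rep S (G ⧸ H) :=
  Rep.of (Representation.ofQuotient (tateAction H A q) H)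

/-- The `G ⧸ H`-equivariant map `Ĥ^q(H; A) → Ĥ^q(H; B)` induced by a `G`-equivariant `A → B`. -/
def tateRepMap {A B : Rep S G} (q : ℤ) (f : A ⟶ B) : tateRep H A q ⟶ tateRep H B q :=
  Rep.ofHom ⟨tateMap q ((Rep.resFunctor H.subtype).map f), fun g => by
    obtain ⟨g, rfl⟩ := QuotientGroup.mk_surjective g
    change tateMap q _ ∘ₗ tateMap q _ = tateMap q _ ∘ₗ tateMap q _
    rw [← tateMap_comp, ← tateMap_comp, ← CategoryTheory.Functor.map_comp,
      ← CategoryTheory.Functor.map_comp, Rep.applyAsHom_comm]⟩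

end QuotientAction

/-! ### Localization and completion of representations -/

section LocComp

/-- The localization of endomorphisms. -/
def locEnd {S V : Type} [CommRing S] [AddCommGroup V] [Module S V] (P : Submonoid S) :
    Module.End S V →+* Module.End S (LocalizedModule P V) where
  toFun f := IsLocalizedModule.map P (LocalizedModule.mkLinearMap P V)
    (LocalizedModule.mkLinearMap P V) f
  map_one' := IsLocalizedModule.map_id _ _
  map_mul' f g := IsLocalizedModule.map_comp' P _ _ _ g f
  map_zero' := map_zero _
  map_add' f g := map_add _ f g

/-- The localization `P⁻¹ V` of a representation `V`. -/
def locRep {S G : Type} [CommRing S] [Group G] (P : Submonoid S) (A : Rep S G) : Rep S G :=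
  Rep.of (X := LocalizedModule P A.V)
    (((locEnd P : Module.End S A.V →+* _) : Module.End S A.V →* _).comp A.ρ)

/-- The canonical map `V → P⁻¹ V`. -/
def toLoc {S G : Type} [CommRing S] [Group G] (P : Submonoid S) (A : Rep S G) :
    A ⟶ locRep P A :=
  Rep.ofHom (ρ := A.ρ) ⟨LocalizedModule.mkLinearMap P A.V, fun g =>
    (IsLocalizedModule.map_comp P _ _ (A.ρ g)).symm⟩

variable {S R V G : Type} [CommRing S] [CommRing R] [AddCommGroup V] [Module S V] [Module R V]
  [SMul S R] [IsScalarTower S R V] [Group G] (I : Ideal R)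

/-- The additive endomorphism of `V / p` induced by an endomorphism of `V` preserving `p`. -/
def quotEnd {S R V : Type} [CommRing S] [CommRing R] [AddCommGroup V] [Module S V] [Module R V]
    (p : Submodule R V) (f : V →ₗ[S] V) (hf : ∀ v ∈ p, f v ∈ p) : V ⧸ p →+ V ⧸ p :=
  QuotientAddGroup.map p.toAddSubgroup p.toAddSubgroup f.toAddMonoidHom hf

theorem quotEnd_mk {S R V : Type} [CommRing S] [CommRing R] [AddCommGroup V] [Module S V]
    [Module R V] (p : Submodule R V) (f : V →ₗ[S] V) (hf : ∀ v ∈ p, f v ∈ p) (v : V) :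
    quotEnd p f hf (Submodule.Quotient.mk v) = Submodule.Quotient.mk (f v) := rfl

theorem transitionMap_quotEnd {S R V : Type} [CommRing S] [CommRing R] [AddCommGroup V]
    [Module S V] [Module R V] (I : Ideal R) (f : V →ₗ[S] V)
    (hf : ∀ n : ℕ, ∀ v ∈ (I ^ n • ⊤ : Submodule R V), f v ∈ (I ^ n • ⊤ : Submodule R V))
    (y : AdicCompletion I V) {m n : ℕ} (hmn : m ≤ n) :
    AdicCompletion.transitionMap I V hmn
      (quotEnd (I ^ n • ⊤ : Submodule R V) f (hf n) (y.val n)) =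
      quotEnd (I ^ m • ⊤ : Submodule R V) f (hf m) (y.val m) := by
  have hy := y.property hmn
  obtain ⟨v, hv⟩ := Submodule.Quotient.mk_surjective _ (y.val n)
  have hmk (w : V) : AdicCompletion.transitionMap I V hmn (Submodule.Quotient.mk w) =
    Submodule.Quotient.mk w := rfl
  rw [← hy, ← hv, quotEnd_mk, hmk, hmk, quotEnd_mk]

/-- An `S`-linear endomorphism of `V` that preserves all the submodules `I ^ n V` induces a map
on the `I`-adic completion `lim V / I ^ n V`. -/
def complFun (f : V →ₗ[S] V)
    (hf : ∀ n : ℕ, ∀ v ∈ (I ^ n • ⊤ : Submodule R V), f v ∈ (I ^ n • ⊤ : Submodule R V))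
    (y : AdicCompletion I V) : AdicCompletion I V :=
  ⟨fun n => quotEnd (I ^ n • ⊤ : Submodule R V) f (hf n) (y.val n),
    fun hmn => transitionMap_quotEnd I f hf y hmn⟩

theorem complFun_val (f : V →ₗ[S] V)
    (hf : ∀ n : ℕ, ∀ v ∈ (I ^ n • ⊤ : Submodule R V), f v ∈ (I ^ n • ⊤ : Submodule R V))
    (y : AdicCompletion I V) (n : ℕ) :
    (complFun I f hf y).val n = quotEnd (I ^ n • ⊤ : Submodule R V) f (hf n) (y.val n) := rfl

/-- The map `complFun` as a linear map. -/
def complEnd (f : V →ₗ[S] V)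
    (hf : ∀ n : ℕ, ∀ v ∈ (I ^ n • ⊤ : Submodule R V), f v ∈ (I ^ n • ⊤ : Submodule R V)) :
    AdicCompletion I V →ₗ[S] AdicCompletion I V where
  toFun := complFun I f hf
  map_add' y z := AdicCompletion.ext fun n => by
    rw [AdicCompletion.val_add_apply, complFun_val, complFun_val, complFun_val,
      AdicCompletion.val_add_apply, map_add]
  map_smul' s y := AdicCompletion.ext fun n => by
    obtain ⟨v, hv⟩ := Submodule.Quotient.mk_surjective _ (y.val n)
    rw [RingHom.id_apply, AdicCompletion.val_smul_apply, complFun_val, complFun_val,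
      AdicCompletion.val_smul_apply, ← hv, ← Submodule.Quotient.mk_smul, quotEnd_mk, quotEnd_mk,
      ← Submodule.Quotient.mk_smul, map_smul]

theorem complEnd_val (f : V →ₗ[S] V)
    (hf : ∀ n : ℕ, ∀ v ∈ (I ^ n • ⊤ : Submodule R V), f v ∈ (I ^ n • ⊤ : Submodule R V))
    (y : AdicCompletion I V) (n : ℕ) :
    (complEnd I f hf y).val n = quotEnd (I ^ n • ⊤ : Submodule R V) f (hf n) (y.val n) := rfl

/-- The `I`-adic completion of a representation whose operators preserve the `I`-adic filtration. -/
def complRep (ρ : Representation S G V)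
    (hρ : ∀ g, ∀ n : ℕ, ∀ v ∈ (I ^ n • ⊤ : Submodule R V),
      ρ g v ∈ (I ^ n • ⊤ : Submodule R V)) :
    Representation S G (AdicCompletion I V) where
  toFun g := complEnd I (ρ g) (hρ g)
  map_one' := LinearMap.ext fun y => AdicCompletion.ext fun n => by
    obtain ⟨v, hv⟩ := Submodule.Quotient.mk_surjective _ (y.val n)
    rw [complEnd_val, Module.End.one_apply, ← hv, quotEnd_mk, map_one,
      Module.End.one_apply]
  map_mul' g h := LinearMap.ext fun y => AdicCompletion.ext fun n => by
    obtain ⟨v, hv⟩ := Submodule.Quotient.mk_surjective _ (y.val n)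
    rw [Module.End.mul_apply, complEnd_val, complEnd_val, complEnd_val, ← hv, quotEnd_mk,
      quotEnd_mk, quotEnd_mk, map_mul, Module.End.mul_apply]

theorem complRep_of_val (ρ : Representation S G V)
    (hρ : ∀ g, ∀ n : ℕ, ∀ v ∈ (I ^ n • ⊤ : Submodule R V),
      ρ g v ∈ (I ^ n • ⊤ : Submodule R V)) (g : G) (v : V) (n : ℕ) :
    (complRep I ρ hρ g (AdicCompletion.of I V v)).val n =
      (AdicCompletion.of I V (ρ g v)).val n := by
  change (complEnd I (ρ g) (hρ g) _).val n = _
  rw [complEnd_val, AdicCompletion.of_apply, AdicCompletion.of_apply, Submodule.mkQ_apply,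
    Submodule.mkQ_apply, quotEnd_mk]

/-- The canonical equivariant map from a representation to its completion. -/
def toCompl (ρ : Representation S G V)
    (hρ : ∀ g, ∀ n : ℕ, ∀ v ∈ (I ^ n • ⊤ : Submodule R V),
      ρ g v ∈ (I ^ n • ⊤ : Submodule R V)) :
    Rep.of ρ ⟶ Rep.of (complRep I ρ hρ) :=
  Rep.ofHom ⟨{ toFun := AdicCompletion.of I V
               map_add' := map_add _
               map_smul' := fun _ _ => rfl }, fun g => LinearMap.ext fun v =>
    AdicCompletion.ext fun n => (complRep_of_val I ρ hρ g v n).symm⟩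

/-- Semilinear operators preserve the `I`-adic filtration as soon as the ring maps preserve `I`. -/
theorem filtration_stable (f : V →+ V) (σ : R →+* R) (hσ : I.map σ ≤ I)
    (hf : ∀ (r : R) (v : V), f (r • v) = σ r • f v) (n : ℕ) :
    ∀ v ∈ (I ^ n • ⊤ : Submodule R V), f v ∈ (I ^ n • ⊤ : Submodule R V) := by
  intro v hv
  induction hv using Submodule.smul_induction_on' with
  | smul r hr v _ =>
    rw [hf]
    refine Submodule.smul_mem_smul ?_ trivial
    have : (I ^ n).map σ ≤ I ^ n := by rw [Ideal.map_pow]; exact Ideal.pow_right_mono hσ n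
    exact this (Ideal.mem_map_of_mem σ hr)
  | add x _ y _ hx hy => rw [map_add]; exact add_mem hx hy

end LocComp

/-! ### Commutative rings with an action of an abelian group -/

section RingAction

variable {k A G : Type} [CommRing k] [CommRing A] [Algebra k A] [CommGroup G]
  (φ : G →* (A →ₐ[k] A)) (H : Subgroup G)

/-- The ring `A^H` of invariants of a subgroup `H`. -/
def inv : Subalgebra k A where
  carrier := {a | ∀ g ∈ H, φ g a = a}
  mul_mem' ha hb g hg := by rw [map_mul, ha g hg, hb g hg]
  add_mem' ha hb g hg := by rw [map_add, ha g hg, hb g hg]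
  algebraMap_mem' r g _ := (φ g).commutes r

/-- The inclusion `A^G ⊆ A^H` as an algebra structure. -/
instance : Algebra (inv φ ⊤) (inv φ H) :=
  (Subalgebra.inclusion (S := inv φ ⊤) (T := inv φ H) (fun _ hm g _ => hm g trivial)).toAlgebra

/-- The action of `G` on `A^H`. -/
def invAct (g : G) : inv φ H →+* inv φ H where
  toFun b := ⟨φ g b.1, fun h hh => by
    rw [← AlgHom.mul_apply, ← map_mul, mul_comm, map_mul, AlgHom.mul_apply, b.2 h hh]⟩
  map_one' := Subtype.ext (map_one (φ g))
  map_mul' a b := Subtype.ext (map_mul (φ g) a.1 b.1)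
  map_zero' := Subtype.ext (map_zero (φ g))
  map_add' a b := Subtype.ext (map_add (φ g) a.1 b.1)

/-- `A` as a representation of `G` over `A^G`. -/
def ringRep : Rep (inv φ ⊤) G :=
  Rep.of (X := A)
    { toFun g :=
        { toFun := φ g
          map_add' := map_add _
          map_smul' := fun s m => by
            change φ g (s.1 * m) = s.1 * φ g m
            rw [map_mul, s.2 g trivial] }
      map_one' := by ext m; change φ 1 m = m; rw [map_one]; rfl
      map_mul' := fun g h => by ext m; change φ (g * h) m = φ g (φ h m); rw [map_mul]; rfl }

/-- Multiplication by an element of `A^H` is an `H`-equivariant endomorphism of `A`. -/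
def mulHom (b : inv φ H) : Rep.res H.subtype (ringRep φ) ⟶ Rep.res H.subtype (ringRep φ) :=
  Rep.ofHom (ρ := (Rep.res H.subtype (ringRep φ)).ρ) (σ := (Rep.res H.subtype (ringRep φ)).ρ)
    ⟨(LinearMap.mulLeft (inv φ ⊤) b.1 : A →ₗ[inv φ ⊤] A), fun h => by
      refine LinearMap.ext fun (m : A) => ?_
      change b.1 * φ h.1 m = φ h.1 (b.1 * m)
      rw [map_mul, b.2 h.1 h.2]⟩

variable [Fintype H]

/-- The underlying module of `Ĥ^q(H; A)`. -/
def TateMod (q : ℤ) : Type := (tateRep H (ringRep φ) q).V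

instance (q : ℤ) : AddCommGroup (TateMod φ H q) :=
  inferInstanceAs (AddCommGroup (tateRep H (ringRep φ) q).V)

instance (q : ℤ) : Module (inv φ ⊤) (TateMod φ H q) :=
  inferInstanceAs (Module (inv φ ⊤) (tateRep H (ringRep φ) q).V)

/-- The action of `A^H` on `Ĥ^q(H; A)` by functoriality. -/
def tateScalar (q : ℤ) : inv φ H →+* Module.End (inv φ ⊤) (TateMod φ H q) where
  toFun b := tateMap q (mulHom φ H b)
  map_one' := by
    have : mulHom φ H 1 = 𝟙 _ := by ext m; exact one_mul (M := A) m
    rw [this, tateMap_id]; rfl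
  map_mul' a b := by
    have : mulHom φ H (a * b) = mulHom φ H b ≫ mulHom φ H a := by
      ext m; exact mul_assoc (G := A) a.1 b.1 m
    rw [this, tateMap_comp]; rfl
  map_zero' := by
    have : mulHom φ H 0 = 0 := by ext m; exact zero_mul (M₀ := A) m
    rw [this, tateMap_zero]; rfl
  map_add' a b := by
    have : mulHom φ H (a + b) = mulHom φ H a + mulHom φ H b := by
      ext m; exact add_mul (R := A) a.1 b.1 m
    rw [this, tateMap_add]; rfl

variable (t : inv φ ⊤)

/-- The underlying module of the localization `t⁻¹ Ĥ^q(H; A)` at an invariant element `t`. -/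
def LocTateMod (q : ℤ) : Type := LocalizedModule (Submonoid.powers t) (TateMod φ H q)

instance (q : ℤ) : AddCommGroup (LocTateMod φ H t q) :=
  inferInstanceAs (AddCommGroup (LocalizedModule (Submonoid.powers t) (TateMod φ H q)))

instance (q : ℤ) : Module (inv φ ⊤) (LocTateMod φ H t q) :=
  inferInstanceAs (Module (inv φ ⊤) (LocalizedModule (Submonoid.powers t) (TateMod φ H q)))

/-- The action of `A^H` on `t⁻¹ Ĥ^q(H; A)`. -/
def locTateScalar (q : ℤ) : inv φ H →+* Module.End (inv φ ⊤) (LocTateMod φ H t q) :=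
  (locEnd (Submonoid.powers t)).comp (tateScalar φ H q)

instance (q : ℤ) : Module (inv φ H) (LocTateMod φ H t q) :=
  Module.compHom _ (locTateScalar φ H t q)

theorem locTate_smul_def (q : ℤ) (b : inv φ H) (v : LocTateMod φ H t q) :
    b • v = locTateScalar φ H t q b v := rfl

theorem tateScalar_algebraMap (q : ℤ) (s : inv φ ⊤) :
    tateScalar φ H q (algebraMap (inv φ ⊤) (inv φ H) s) = s • LinearMap.id := by
  have : mulHom φ H (algebraMap (inv φ ⊤) (inv φ H) s) = s • 𝟙 _ := by
    ext m; rfl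
  change tateMap q (mulHom φ H (algebraMap (inv φ ⊤) (inv φ H) s)) = _
  rw [this, tateMap_smul, tateMap_id]; rfl

instance (q : ℤ) : IsScalarTower (inv φ ⊤) (inv φ H) (LocTateMod φ H t q) where
  smul_assoc s b v := by
    rw [Algebra.smul_def, mul_smul, locTate_smul_def]
    change locEnd (Submonoid.powers t) (tateScalar φ H q _) (b • v) = _
    rw [tateScalar_algebraMap]
    have : locEnd (Submonoid.powers t) (s • (LinearMap.id : Module.End (inv φ ⊤) (TateMod φ H q)))
        = s • LinearMap.id := by
      change IsLocalizedModule.map _ _ _ (s • LinearMap.id) = _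
      rw [map_smul, IsLocalizedModule.map_id]
    rw [this]; rfl

/-- `t⁻¹ Ĥ^q(H; A)` as a representation of `G ⧸ H`. -/
def locTateRep (q : ℤ) : Representation (inv φ ⊤) (G ⧸ H) (LocTateMod φ H t q) :=
  (locRep (Submonoid.powers t) (tateRep H (ringRep φ) q)).ρ

theorem locTateRep_smul (q : ℤ) (g : G) (b : inv φ H) (v : LocTateMod φ H t q) :
    locTateRep φ H t q (g : G ⧸ H) (b • v) =
      invAct φ H g b • locTateRep φ H t q (g : G ⧸ H) v := by
  let f : Module.End (inv φ ⊤) (TateMod φ H q) := tateAction H (ringRep φ) q g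
  have h1 : f * tateScalar φ H q b = tateScalar φ H q (invAct φ H g b) * f := by
    change tateMap q _ ∘ₗ tateMap q _ = tateMap q _ ∘ₗ tateMap q _
    rw [← tateMap_comp, ← tateMap_comp]
    congr 1
    ext m
    exact map_mul (φ g) b.1 m
  have h2 := congrArg (locEnd (Submonoid.powers t)) h1
  rw [map_mul, map_mul] at h2
  exact LinearMap.congr_fun h2 v

/-- Every element of `G ⧸ H` preserves the `J`-adic filtration of `t⁻¹ Ĥ^q(H; A)` if `J` is
`G`-stable. -/
theorem locTateRep_stable (J : Ideal (inv φ H)) (hJ : ∀ g, J.map (invAct φ H g) ≤ J) (q : ℤ)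
    (c : G ⧸ H) (n : ℕ) (v : LocTateMod φ H t q)
    (hv : v ∈ (J ^ n • ⊤ : Submodule (inv φ H) (LocTateMod φ H t q))) :
    locTateRep φ H t q c v ∈ (J ^ n • ⊤ : Submodule (inv φ H) (LocTateMod φ H t q)) := by
  obtain ⟨g, rfl⟩ := QuotientGroup.mk_surjective c
  exact filtration_stable J (locTateRep φ H t q (g : G ⧸ H)).toAddMonoidHom (invAct φ H g) (hJ g)
    (locTateRep_smul φ H t q g) n v hv

/-- `Ĥ^q(H; A)` as an object of the category of representations of `G ⧸ H` over `A^G`. -/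
abbrev N (q : ℤ) : Rep (inv φ ⊤) (G ⧸ H) := tateRep H (ringRep φ) q

/-- `t⁻¹ Ĥ^q(H; A)` as an object of the category of representations of `G ⧸ H` over `A^G`. -/
abbrev locN (q : ℤ) : Rep (inv φ ⊤) (G ⧸ H) := Rep.of (locTateRep φ H t q)

/-- The completion `(t⁻¹ Ĥ^q(H; A))^∧_J`, for an ideal `J` of `A^H`, as an object of the category
of representations of `G ⧸ H` over `A^G`. -/
abbrev complN (J : Ideal (inv φ H)) (hJ : ∀ g, J.map (invAct φ H g) ≤ J) (q : ℤ) :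
    Rep (inv φ ⊤) (G ⧸ H) :=
  Rep.of (complRep J (locTateRep φ H t q) (locTateRep_stable φ H t J hJ q))

/-- The localization map `Ĥ^q(H; A) → t⁻¹ Ĥ^q(H; A)`. -/
def toLocN (q : ℤ) : N φ H q ⟶ locN φ H t q :=
  toLoc (Submonoid.powers t) (tateRep H (ringRep φ) q)

/-- The completion map `t⁻¹ Ĥ^q(H; A) → (t⁻¹ Ĥ^q(H; A))^∧_J`. -/
def toComplN (J : Ideal (inv φ H)) (hJ : ∀ g, J.map (invAct φ H g) ≤ J) (q : ℤ) :
    locN φ H t q ⟶ complN φ H t J hJ q :=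
  toCompl J (locTateRep φ H t q) (locTateRep_stable φ H t J hJ q)

end RingAction

section RingCompletion

variable {k A G : Type} [CommRing k] [CommRing A] [Algebra k A] [CommGroup G]
  (φ : G →* (A →ₐ[k] A)) (t : inv φ ⊤)

/-- The localization `t⁻¹ A`. -/
abbrev Loc : Type := Localization.Away (t : A)

/-- The action of `G` on `t⁻¹ A`. -/
def locAct (g : G) : Loc φ t →+* Loc φ t :=
  IsLocalization.map (M := Submonoid.powers (t : A)) (T := Submonoid.powers (t : A)) (Loc φ t)
    (φ g : A →+* A) (Submonoid.powers_le.2 ⟨1, by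
      simpa using (t.2 g trivial).symm⟩)

theorem locAct_algebraMap (g : G) (a : A) :
    locAct φ t g (algebraMap A (Loc φ t) a) = algebraMap A (Loc φ t) (φ g a) :=
  IsLocalization.map_eq _ _

/-- `t⁻¹ A` as a representation of `G` over `A^G`. -/
def locRingRep : Representation (inv φ ⊤) G (Loc φ t) where
  toFun g :=
    { toFun := locAct φ t g
      map_add' := map_add _
      map_smul' := fun s m => by
        have h (y : Loc φ t) : s • y = algebraMap A (Loc φ t) s.1 * y := by
          rw [← Algebra.smul_def]; rfl
        rw [h, map_mul, locAct_algebraMap, s.2 g trivial, RingHom.id_apply, h] }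
  map_one' := by
    have : locAct φ t 1 = RingHom.id _ :=
      IsLocalization.ringHom_ext (Submonoid.powers (t : A)) (RingHom.ext fun a => by
        simp [locAct_algebraMap])
    exact LinearMap.ext fun m => RingHom.congr_fun this m
  map_mul' g h := by
    have : locAct φ t (g * h) = (locAct φ t g).comp (locAct φ t h) :=
      IsLocalization.ringHom_ext (Submonoid.powers (t : A)) (RingHom.ext fun a => by
        simp [locAct_algebraMap])
    exact LinearMap.ext fun m => RingHom.congr_fun this m

theorem locRingRep_stable (I : Ideal A) (hI : ∀ g, I.map (φ g : A →+* A) ≤ I) (g : G) (n : ℕ)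
    (v : Loc φ t) (hv : v ∈ (I.map (algebraMap A (Loc φ t)) ^ n • ⊤ : Ideal (Loc φ t))) :
    locRingRep φ t g v ∈ (I.map (algebraMap A (Loc φ t)) ^ n • ⊤ : Ideal (Loc φ t)) := by
  refine filtration_stable _ (locAct φ t g).toAddMonoidHom (locAct φ t g) ?_
    (fun r v => map_mul (locAct φ t g) r v) n v hv
  rw [Ideal.map_map, Ideal.map_le_iff_le_comap]
  intro a ha
  rw [Ideal.mem_comap, RingHom.comp_apply, locAct_algebraMap]
  exact Ideal.mem_map_of_mem _ (hI g (Ideal.mem_map_of_mem (φ g : A →+* A) ha))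

/-- The completion `(t⁻¹ A)^∧_I` as a representation of `G` over `A^G`. -/
def complRingRep (I : Ideal A) (hI : ∀ g, I.map (φ g : A →+* A) ≤ I) : Rep (inv φ ⊤) G :=
  Rep.of (complRep (I.map (algebraMap A (Loc φ t))) (locRingRep φ t) (locRingRep_stable φ t I hI))

/-- The canonical map `A → t⁻¹ A → (t⁻¹ A)^∧_I`. -/
def toComplRing (I : Ideal A) (hI : ∀ g, I.map (φ g : A →+* A) ≤ I) :
    ringRep φ ⟶ complRingRep φ t I hI :=
  Rep.ofHom (ρ := (ringRep φ).ρ) (σ := locRingRep φ t)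
    ⟨(IsScalarTower.toAlgHom (inv φ ⊤) A (Loc φ t)).toLinearMap, fun g =>
      LinearMap.ext fun (a : A) => (locAct_algebraMap φ t g a).symm⟩ ≫
    toCompl (I.map (algebraMap A (Loc φ t))) (locRingRep φ t) (locRingRep_stable φ t I hI)

end RingCompletion

/-! ### The ring `M = Sym(Ind_{C₃}^{C₉} ρ̄)` -/

/-- `𝕎 = W(𝔽_{3⁶})`. -/
abbrev W : Type := WittVector 3 (GaloisField 3 6)

/-- The cyclic group `C₉`, written multiplicatively. -/
abbrev C9 : Type := Multiplicative (ZMod 9)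

/-- The generator `γ` of `C₉`. -/
def γ : C9 := Multiplicative.ofAdd 1

/-- The subgroup `C₃ = ⟨γ³⟩` of `C₉`. -/
def C3 : Subgroup C9 := Subgroup.zpowers (γ ^ 3)

instance : Fintype C3 := Fintype.ofFinite _

/-- The ideal `(x₀ + x₃ + x₆, x₁ + x₄ + x₇, x₂ + x₅ + x₈)`; indices are taken modulo 9, so that
each generator is listed three times. -/
def relIdeal : Ideal (MvPolynomial (ZMod 9) W) :=
  Ideal.span (Set.range fun j : ZMod 9 =>
    MvPolynomial.X j + MvPolynomial.X (j + 3) + MvPolynomial.X (j + 6))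

/-- `M = 𝕎[x₀, …, x₈] / (x₀ + x₃ + x₆, x₁ + x₄ + x₇, x₂ + x₅ + x₈)`, that is,
`Sym(Ind_{C₃}^{C₉} ρ̄)`. -/
def M : Type := MvPolynomial (ZMod 9) W ⧸ relIdeal

instance : CommRing M := inferInstanceAs (CommRing (MvPolynomial (ZMod 9) W ⧸ relIdeal))

instance : Algebra W M := inferInstanceAs (Algebra W (MvPolynomial (ZMod 9) W ⧸ relIdeal))

/-- The quotient map `𝕎[x₀, …, x₈] → M`. -/
def toM : MvPolynomial (ZMod 9) W →ₐ[W] M := Ideal.Quotient.mkₐ W relIdeal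

theorem toM_surjective : Function.Surjective toM := Ideal.Quotient.mkₐ_surjective W relIdeal

/-- The class of the variable `x_i` in `M`. -/
def x (i : ZMod 9) : M := toM (MvPolynomial.X i)

theorem M_ext {f g : M →ₐ[W] M} (h : ∀ i, f (x i) = g (x i)) : f = g := by
  have h' : f.comp toM = g.comp toM := MvPolynomial.algHom_ext h
  ext m
  obtain ⟨p, rfl⟩ := toM_surjective m
  exact AlgHom.congr_fun h' p

theorem relIdeal_le (a : ZMod 9) :
    relIdeal ≤ relIdeal.comap (MvPolynomial.rename (R := W) (fun i : ZMod 9 => i + a)) := by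
  refine Ideal.span_le.2 ?_
  rintro _ ⟨j, rfl⟩
  refine Ideal.subset_span ⟨j + a, ?_⟩
  simp only [map_add, MvPolynomial.rename_X]
  rw [add_right_comm j a 3, add_right_comm j a 6]

/-- The `𝕎`-algebra endomorphism of `M` with `x_i ↦ x_{i+a}`. -/
def shift (a : ZMod 9) : M →ₐ[W] M :=
  Ideal.quotientMapₐ relIdeal (MvPolynomial.rename (fun i : ZMod 9 => i + a)) (relIdeal_le a)

theorem shift_x (a i : ZMod 9) : shift a (x i) = x (i + a) := by
  change toM (MvPolynomial.rename (fun i : ZMod 9 => i + a) (MvPolynomial.X i)) = _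
  rw [MvPolynomial.rename_X]; rfl

/-- The action of `C₉` on `M` by `𝕎`-algebra maps with `γ x_i = x_{i+1}`. -/
def act : C9 →* (M →ₐ[W] M) where
  toFun g := shift (Multiplicative.toAdd g)
  map_one' := M_ext fun i => by rw [shift_x]; simp
  map_mul' g h := M_ext fun i => by
    rw [AlgHom.mul_apply, shift_x, shift_x, shift_x, toAdd_mul, add_assoc, add_comm (g.toAdd)]

theorem act_x (g : C9) (i : ZMod 9) : act g (x i) = x (i + g.toAdd) := shift_x _ _

/-- `x_j x_{j+3} x_{j+6}` as an element of `M`. -/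
def dM (j : ZMod 9) : M := x j * x (j + 3) * x (j + 6)

theorem act_dM (g : C9) (j : ZMod 9) : act g (dM j) = dM (j + g.toAdd) := by
  simp only [dM, map_mul, act_x, add_right_comm]

theorem dM_add_three (j : ZMod 9) : dM (j + 3) = dM j := by
  have h1 : j + 3 + 3 = j + 6 := by rw [add_assoc]; rfl
  have h2 : j + 3 + 6 = j := by
    rw [add_assoc, show (3 + 6 : ZMod 9) = 0 from rfl, add_zero]
  rw [dM, dM, h1, h2]; ring

theorem const_of_add_one {X : Type} (f : ZMod 9 → X) (hf : ∀ a, f (a + 1) = f a) (a : ZMod 9) :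
    f a = f 0 := by
  have h (n : ℕ) : f (n : ZMod 9) = f 0 := by
    induction n with
    | zero => simp
    | succ n ih => rw [Nat.cast_succ, hf, ih]
  rw [← h a.val, ZMod.natCast_zmod_val]

theorem dM_mem (j : ZMod 9) : dM j ∈ inv act C3 := fun g hg => by
  obtain ⟨n, rfl⟩ := mem_powers_iff_mem_zpowers.2 hg
  have h : act (γ ^ 3) (dM j) = dM j := by
    rw [act_dM]; exact dM_add_three j
  dsimp only
  induction n with
  | zero => rw [pow_zero, map_one]; rfl
  | succ n ih =>
    rw [pow_succ, map_mul, AlgHom.mul_apply, h]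
    exact ih ⟨n, by simp⟩

/-- The elements `d_j = x_j x_{j+3} x_{j+6}` of `M^{C₃}`: `d 0`, `d 1`, `d 2` are the elements
`d₁ = x₀x₃x₆`, `d₂ = x₁x₄x₇`, `d₃ = x₂x₅x₈`. -/
def d (j : ZMod 9) : inv act C3 := ⟨dM j, dM_mem j⟩

/-- `s₁ = d₁ + d₂ + d₃`, an element of `M^{C₉}`. -/
def s₁ : inv act ⊤ := ⟨dM 0 + dM 1 + dM 2, fun g _ => by
  simp only [map_add, act_dM]
  refine (const_of_add_one (fun a => dM (0 + a) + dM (1 + a) + dM (2 + a)) (fun a => ?_)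
    g.toAdd).trans (by simp)
  have h0 : (0 + (a + 1) : ZMod 9) = 1 + a := by ring
  have h1 : (1 + (a + 1) : ZMod 9) = 2 + a := by ring
  have h2 : (2 + (a + 1) : ZMod 9) = 0 + a + 3 := by ring
  simp only [h0, h1, h2, dM_add_three]
  ring⟩

/-- `s₂ = d₁d₂ + d₂d₃ + d₃d₁`, an element of `M^{C₉}`. -/
def s₂ : inv act ⊤ := ⟨dM 0 * dM 1 + dM 1 * dM 2 + dM 2 * dM 0, fun g _ => by
  simp only [map_add, map_mul, act_dM]
  refine (const_of_add_one (fun a => dM (0 + a) * dM (1 + a) + dM (1 + a) * dM (2 + a) +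
    dM (2 + a) * dM (0 + a)) (fun a => ?_) g.toAdd).trans (by simp)
  have h0 : (0 + (a + 1) : ZMod 9) = 1 + a := by ring
  have h1 : (1 + (a + 1) : ZMod 9) = 2 + a := by ring
  have h2 : (2 + (a + 1) : ZMod 9) = 0 + a + 3 := by ring
  simp only [h0, h1, h2, dM_add_three]
  ring⟩

/-- `Δ = x₀ x₁ ⋯ x₈`, an element of `M^{C₉}`. -/
def Δ : inv act ⊤ := ⟨∏ i : ZMod 9, x i, fun g _ => by
  rw [map_prod]
  exact Fintype.prod_equiv (Equiv.addRight g.toAdd) _ _ fun i => act_x g i⟩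

/-- The ideal `I = (3, x₀ - x₁, …, x₇ - x₈)` of `M`; indices are taken modulo 9, so that the
redundant generator `x₈ - x₀` is listed too. -/
def I : Ideal M := Ideal.span (insert 3 (Set.range fun i : ZMod 9 => x i - x (i + 1)))

theorem I_stable (g : C9) : I.map (act g : M →+* M) ≤ I := by
  refine Ideal.map_le_iff_le_comap.2 (Ideal.span_le.2 ?_)
  rintro _ (rfl | ⟨i, rfl⟩)
  · change act g 3 ∈ I
    rw [map_ofNat]
    exact Ideal.subset_span (Set.mem_insert _ _)
  · change act g (x i - x (i + 1)) ∈ I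
    rw [map_sub, act_x, act_x, add_right_comm]
    exact Ideal.subset_span (Set.mem_insert_of_mem _ ⟨_, rfl⟩)

/-- The ideal `J = (d₁ - d₂, d₁ - d₃)` of `M^{C₃}`. -/
def J : Ideal (inv act C3) := Ideal.span {d 0 - d 1, d 0 - d 2}

theorem d_sub_mem (j : ZMod 9) : d 0 - d j ∈ J := by
  have h1 : d 0 - d 1 ∈ J := Ideal.subset_span (by simp)
  have h2 : d 0 - d 2 ∈ J := Ideal.subset_span (by simp)
  have h3 (i : ZMod 9) : d (i + 3) = d i := Subtype.ext (dM_add_three i)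
  have key := const_of_add_one (fun a => d 0 - d a ∈ J ∧ d 0 - d (a + 1) ∈ J ∧ d 0 - d (a + 2) ∈ J)
    (fun a => by
      have e1 : a + 1 + 1 = a + 2 := by ring
      have e2 : a + 1 + 2 = a + 3 := by ring
      rw [e1, e2, h3]
      exact propext ⟨fun h => ⟨h.2.2, h.1, h.2.1⟩, fun h => ⟨h.2.1, h.2.2, h.1⟩⟩) j
  have h0 : d 0 - d 0 ∈ J ∧ d 0 - d (0 + 1) ∈ J ∧ d 0 - d (0 + 2) ∈ J := by
    refine ⟨by rw [sub_self]; exact J.zero_mem, by rwa [zero_add], by rwa [zero_add]⟩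
  exact (key.mpr h0).1

theorem J_stable (g : C9) : J.map (invAct act C3 g) ≤ J := by
  have h (i j : ZMod 9) : invAct act C3 g (d i - d j) ∈ J := by
    have e : invAct act C3 g (d i - d j) = (d 0 - d (j + g.toAdd)) - (d 0 - d (i + g.toAdd)) := by
      rw [map_sub, sub_sub_sub_cancel_left]
      exact congrArg₂ (· - ·) (Subtype.ext (act_dM g i)) (Subtype.ext (act_dM g j))
    rw [e]
    exact J.sub_mem (d_sub_mem _) (d_sub_mem _)
  refine Ideal.map_le_iff_le_comap.2 (Ideal.span_le.2 ?_)
  rintro _ (rfl | rfl)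
  · exact h 0 1
  · exact h 0 2

/-! ### The three groups -/

/-- The map on group cohomology `H^p(Q; -)` induced by a morphism of representations of `Q`. -/
abbrev cohMap {S Q : Type} [CommRing S] [Group Q] {X Y : Rep S Q} (f : X ⟶ Y) (p : ℕ) :
    groupCohomology X p →ₗ[S] groupCohomology Y p :=
  (groupCohomology.map (MonoidHom.id Q) f p).hom

/-- `H^p(C₉/C₃; Ĥ^q(C₃; M))`, a module over `M^{C₉}`. -/
abbrev E₂ (p : ℕ) (q : ℤ) : ModuleCat (inv act ⊤) :=
  groupCohomology (N act C3 q) p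

/-- `H^p(C₉/C₃; Δ⁻¹ N^q)` with `N^q = Ĥ^q(C₃; M)`. -/
abbrev E₂loc (p : ℕ) (q : ℤ) : ModuleCat (inv act ⊤) :=
  groupCohomology (locN act C3 Δ q) p

/-- `H^p(C₉/C₃; Ĥ^q(C₃; (Δ⁻¹ M)^∧_I))`. -/
abbrev E₂complI (p : ℕ) (q : ℤ) : ModuleCat (inv act ⊤) :=
  groupCohomology (tateRep C3 (complRingRep act Δ I I_stable) q) p

/-- `H^p(C₉/C₃; (Δ⁻¹ N^q)^∧_J)` with `N^q = Ĥ^q(C₃; M)`. -/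
abbrev E₂complJ (p : ℕ) (q : ℤ) : ModuleCat (inv act ⊤) :=
  groupCohomology (complN act C3 Δ J J_stable q) p

/-- The map `H^p(C₉/C₃; Ĥ^q(C₃; M)) → H^p(C₉/C₃; Ĥ^q(C₃; (Δ⁻¹ M)^∧_I))` induced by
`M → (Δ⁻¹ M)^∧_I`. -/
def toComplI (p : ℕ) (q : ℤ) : E₂ p q →ₗ[inv act ⊤] E₂complI p q :=
  cohMap (tateRepMap C3 q (toComplRing act Δ I I_stable)) p

/-- The map `H^p(C₉/C₃; N^q) → H^p(C₉/C₃; Δ⁻¹ N^q)` induced by `N^q → Δ⁻¹ N^q`. -/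
def toE₂loc (p : ℕ) (q : ℤ) : E₂ p q →ₗ[inv act ⊤] E₂loc p q :=
  cohMap (toLocN act C3 Δ q) p

/-- The map `H^p(C₉/C₃; Δ⁻¹ N^q) → H^p(C₉/C₃; (Δ⁻¹ N^q)^∧_J)` induced by
`Δ⁻¹ N^q → (Δ⁻¹ N^q)^∧_J`. -/
def toComplJ (p : ℕ) (q : ℤ) : E₂loc p q →ₗ[inv act ⊤] E₂complJ p q :=
  cohMap (toComplN act C3 Δ J J_stable q) p

end SerreCompletion

end

noncomputable section

open CategoryTheory

namespace SerreCompletion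

/-! ### Completions for adic topologies coming from different rings -/

section Topology

variable {S R₁ R₂ V₁ V₂ : Type} [CommRing S] [CommRing R₁] [CommRing R₂]
  [AddCommGroup V₁] [AddCommGroup V₂] [Module S V₁] [Module S V₂] [Module R₁ V₁] [Module R₂ V₂]
  [SMul S R₁] [IsScalarTower S R₁ V₁] [SMul S R₂] [IsScalarTower S R₂ V₂]

/-! Write `S = M^{C₉}`, let `P` be the powers of `Δ`, and let `K ⊆ S` be generated by `s₁`, `s₂`,
`3` and the elementary symmetric functions of the traces `e_j = x_j x_{j+3} + x_{j+3} x_{j+6} +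
x_{j+6} x_j`. All three modules of the theorem turn out to be one and the same object: the `K`-adic
completion of `P⁻¹ E₂`, where `E₂ = H^p(C₉/C₃; N^q)`. This is the predicate `IsLocCompl`, always
stated for a specified map out of the module before localization, so that compatibility with
canonical maps comes along.

Two facts carry the argument. The first is exactness: `S` is noetherian and `M` is finite over it,
and on finite modules over a noetherian ring "localize, then complete" is exact. Hence it commutes
with the homology of complexes of finite modules (`isLocCompl_homologyMap`), in particular with Tate
cohomology of `C₃` and with cohomology of `C₉/C₃`.

The second is a comparison of topologies. On `M`, the ideals `K M` and `I` have the same radical,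
because of the cubic equation `x_j³ + e_j x_j - d_j = 0` (`I_le_radical`, `K_map_le`). On `N^q`,
traces from `C₃` act by zero (`tateMap_normHom`, `tateScalar_trace`), so `3` and the `e_j` may be
added freely to any ideal; after that, `K M^{C₃}` and `J` have the same radical (`K_map_le_J`,
`J_le_radical`). On `H^p(C₉/C₃; Δ⁻¹ N^q)` the trace part of `K` again acts by zero, and only `(s₁,
s₂)` remains.

Finally, a linear map from a completed localization to a `K`-separated module on which `P` acts
injectively is determined on the original module (`locCompl_hom_ext`). This yields equivariance of
the coefficient isomorphism and both compatibilities. -/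

theorem AdicCompletion.exists_rep {R V : Type} [CommRing R] [AddCommGroup V] [Module R V]
    (I : Ideal R) (y : AdicCompletion I V) (k : ℕ) :
    ∃ v : V, ∀ n ≤ k, y.val n = Submodule.Quotient.mk v := by
  obtain ⟨v, hv⟩ := Submodule.Quotient.mk_surjective _ (y.val k)
  refine ⟨v, fun n hn => ?_⟩
  rw [← y.property hn, ← hv]
  rfl

/-- The additive map of quotients induced by a linear map. -/
def quotMap (p₁ : Submodule R₁ V₁) (p₂ : Submodule R₂ V₂) (g : V₁ →ₗ[S] V₂)
    (h : ∀ v ∈ p₁, g v ∈ p₂) : V₁ ⧸ p₁ →+ V₂ ⧸ p₂ :=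
  QuotientAddGroup.map p₁.toAddSubgroup p₂.toAddSubgroup g.toAddMonoidHom h

omit [SMul S R₁] [IsScalarTower S R₁ V₁] [SMul S R₂] [IsScalarTower S R₂ V₂] in
theorem quotMap_mk (p₁ : Submodule R₁ V₁) (p₂ : Submodule R₂ V₂) (g : V₁ →ₗ[S] V₂)
    (h : ∀ v ∈ p₁, g v ∈ p₂) (v : V₁) :
    quotMap p₁ p₂ g h (Submodule.Quotient.mk v) = Submodule.Quotient.mk (g v) := rfl

/-- The map of adic completions induced by a linear map that is continuous for the adic
topologies, which may be defined by ideals of different rings. -/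
def complMapFun (I₁ : Ideal R₁) (I₂ : Ideal R₂) (g : V₁ →ₗ[S] V₂)
    (h : ∀ n, ∃ m, ∀ v ∈ (I₁ ^ m • ⊤ : Submodule R₁ V₁), g v ∈ (I₂ ^ n • ⊤ : Submodule R₂ V₂))
    (y : AdicCompletion I₁ V₁) : AdicCompletion I₂ V₂ :=
  ⟨fun n => quotMap _ (I₂ ^ n • ⊤ : Submodule R₂ V₂) g (h n).choose_spec (y.val (h n).choose), by
    intro m n hmn
    -- The source levels chosen for `m` and `n` need not be ordered, so a representative valid at
    -- both levels is taken.
    obtain ⟨v, hv⟩ := AdicCompletion.exists_rep I₁ y (max (h m).choose (h n).choose)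
    exact (congrArg (fun z => AdicCompletion.transitionMap I₂ V₂ hmn
      (quotMap _ (I₂ ^ n • ⊤ : Submodule R₂ V₂) g (h n).choose_spec z))
        (hv _ (le_max_right _ _))).trans (congrArg (quotMap _ (I₂ ^ m • ⊤ : Submodule R₂ V₂) g
          (h m).choose_spec) (hv _ (le_max_left _ _))).symm⟩

omit [SMul S R₁] [IsScalarTower S R₁ V₁] [SMul S R₂] [IsScalarTower S R₂ V₂] in
theorem complMapFun_val (I₁ : Ideal R₁) (I₂ : Ideal R₂) (g : V₁ →ₗ[S] V₂)
    (h : ∀ n, ∃ m, ∀ v ∈ (I₁ ^ m • ⊤ : Submodule R₁ V₁), g v ∈ (I₂ ^ n • ⊤ : Submodule R₂ V₂))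
    (y : AdicCompletion I₁ V₁) (n : ℕ) :
    (complMapFun I₁ I₂ g h y).val n =
      quotMap _ (I₂ ^ n • ⊤ : Submodule R₂ V₂) g (h n).choose_spec (y.val (h n).choose) := rfl

/-- The map `complMapFun` as a linear map. -/
def complMap (I₁ : Ideal R₁) (I₂ : Ideal R₂) (g : V₁ →ₗ[S] V₂)
    (h : ∀ n, ∃ m, ∀ v ∈ (I₁ ^ m • ⊤ : Submodule R₁ V₁), g v ∈ (I₂ ^ n • ⊤ : Submodule R₂ V₂)) :
    AdicCompletion I₁ V₁ →ₗ[S] AdicCompletion I₂ V₂ where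
  toFun := complMapFun I₁ I₂ g h
  map_add' y z := AdicCompletion.ext fun n => by
    rw [AdicCompletion.val_add_apply, complMapFun_val, complMapFun_val, complMapFun_val,
      AdicCompletion.val_add_apply, map_add]
  map_smul' s y := AdicCompletion.ext fun n => by
    obtain ⟨v, hv⟩ := Submodule.Quotient.mk_surjective _ (y.val (h n).choose)
    rw [RingHom.id_apply, AdicCompletion.val_smul_apply, complMapFun_val, complMapFun_val,
      AdicCompletion.val_smul_apply, ← hv, ← Submodule.Quotient.mk_smul, quotMap_mk, quotMap_mk,
      ← Submodule.Quotient.mk_smul, map_smul]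

theorem complMap_val (I₁ : Ideal R₁) (I₂ : Ideal R₂) (g : V₁ →ₗ[S] V₂)
    (h : ∀ n, ∃ m, ∀ v ∈ (I₁ ^ m • ⊤ : Submodule R₁ V₁), g v ∈ (I₂ ^ n • ⊤ : Submodule R₂ V₂))
    (n : ℕ) : ∃ m, ∀ (y : AdicCompletion I₁ V₁) (v : V₁), y.val m = Submodule.Quotient.mk v →
      (complMap I₁ I₂ g h y).val n = Submodule.Quotient.mk (g v) := by
  refine ⟨(h n).choose, fun y v hv => ?_⟩
  rw [← quotMap_mk _ _ g (h n).choose_spec, ← hv]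
  rfl

theorem complMap_of (I₁ : Ideal R₁) (I₂ : Ideal R₂) (g : V₁ →ₗ[S] V₂)
    (h : ∀ n, ∃ m, ∀ v ∈ (I₁ ^ m • ⊤ : Submodule R₁ V₁), g v ∈ (I₂ ^ n • ⊤ : Submodule R₂ V₂))
    (v : V₁) : complMap I₁ I₂ g h (AdicCompletion.of I₁ V₁ v) = AdicCompletion.of I₂ V₂ (g v) :=
  AdicCompletion.ext fun _ => rfl

theorem complMap_complMap (I₁ : Ideal R₁) (I₂ : Ideal R₂) (g : V₁ →ₗ[S] V₂) (g' : V₂ →ₗ[S] V₁)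
    (h : ∀ n, ∃ m, ∀ v ∈ (I₁ ^ m • ⊤ : Submodule R₁ V₁), g v ∈ (I₂ ^ n • ⊤ : Submodule R₂ V₂))
    (h' : ∀ n, ∃ m, ∀ v ∈ (I₂ ^ m • ⊤ : Submodule R₂ V₂), g' v ∈ (I₁ ^ n • ⊤ : Submodule R₁ V₁))
    (hg : ∀ v, g' (g v) = v) (y : AdicCompletion I₁ V₁) :
    complMap I₂ I₁ g' h' (complMap I₁ I₂ g h y) = y := by
  refine AdicCompletion.ext fun n => ?_
  obtain ⟨m, hm⟩ := complMap_val I₂ I₁ g' h' n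
  obtain ⟨l, hl⟩ := complMap_val I₁ I₂ g h m
  obtain ⟨v, hv⟩ := AdicCompletion.exists_rep I₁ y (max l n)
  rw [hm _ _ (hl _ _ (hv _ (le_max_left _ _))), hg, hv _ (le_max_right _ _)]

/-- A linear homeomorphism for the adic topologies induces an isomorphism of completions. -/
def complEquiv (I₁ : Ideal R₁) (I₂ : Ideal R₂) (g : V₁ ≃ₗ[S] V₂)
    (h : ∀ n, ∃ m, ∀ v ∈ (I₁ ^ m • ⊤ : Submodule R₁ V₁), g v ∈ (I₂ ^ n • ⊤ : Submodule R₂ V₂))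
    (h' : ∀ n, ∃ m, ∀ v ∈ (I₂ ^ m • ⊤ : Submodule R₂ V₂),
      g.symm v ∈ (I₁ ^ n • ⊤ : Submodule R₁ V₁)) :
    AdicCompletion I₁ V₁ ≃ₗ[S] AdicCompletion I₂ V₂ :=
  LinearEquiv.ofLinearMap (complMap I₁ I₂ (g : V₁ →ₗ[S] V₂) h)
    (complMap I₂ I₁ (g.symm : V₂ →ₗ[S] V₁) h')
    (LinearMap.ext fun y => complMap_complMap I₂ I₁ _ _ _ _ g.apply_symm_apply y)
    (LinearMap.ext fun y => complMap_complMap I₁ I₂ _ _ _ _ g.symm_apply_apply y)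

theorem complEquiv_of (I₁ : Ideal R₁) (I₂ : Ideal R₂) (g : V₁ ≃ₗ[S] V₂)
    (h : ∀ n, ∃ m, ∀ v ∈ (I₁ ^ m • ⊤ : Submodule R₁ V₁), g v ∈ (I₂ ^ n • ⊤ : Submodule R₂ V₂))
    (h' : ∀ n, ∃ m, ∀ v ∈ (I₂ ^ m • ⊤ : Submodule R₂ V₂),
      g.symm v ∈ (I₁ ^ n • ⊤ : Submodule R₁ V₁)) (v : V₁) :
    complEquiv I₁ I₂ g h h' (AdicCompletion.of I₁ V₁ v) = AdicCompletion.of I₂ V₂ (g v) :=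
  complMap_of I₁ I₂ _ h v

end Topology

/-! ### Exactness of completion on finite modules over a noetherian ring -/

/-- Factor `f` and `g` through their ranges. The short exact sequence of ranges stays exact after
completion because `B` is finite, `range g ⊆ C` stays injective by Artin–Rees, and surjections are
always preserved. No finiteness of `A` is needed. -/
theorem adicCompletion_map_exact {R A B C : Type} [CommRing R] [IsNoetherianRing R]
    [AddCommGroup A] [AddCommGroup B] [AddCommGroup C] [Module R A] [Module R B] [Module R C]
    [Module.Finite R B] [Module.Finite R C] (I : Ideal R) {f : A →ₗ[R] B} {g : B →ₗ[R] C}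
    (h : Function.Exact f g) :
    Function.Exact (AdicCompletion.map I f) (AdicCompletion.map I g) := by
  have hs : Function.Exact (LinearMap.range f).subtype g.rangeRestrict := by
    intro b
    have : g.rangeRestrict b = 0 ↔ g b = 0 := by
      rw [← Subtype.coe_inj]; rfl
    rw [this, h b]
    simp
  have hex := AdicCompletion.map_exact (I := I) (LinearMap.range f).injective_subtype hs
    g.surjective_rangeRestrict
  have hsurj := AdicCompletion.map_surjective I f.surjective_rangeRestrict
  have hinj := AdicCompletion.map_injective I (LinearMap.range g).injective_subtype
  intro y
  have hf' (w) : AdicCompletion.map I f w = AdicCompletion.map I (LinearMap.range f).subtype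
      (AdicCompletion.map I f.rangeRestrict w) := by rw [AdicCompletion.map_comp_apply]; rfl
  have hg' (w) : AdicCompletion.map I g w = AdicCompletion.map I (LinearMap.range g).subtype
      (AdicCompletion.map I g.rangeRestrict w) := by rw [AdicCompletion.map_comp_apply]; rfl
  constructor
  · intro hy
    rw [hg', ← map_zero (AdicCompletion.map I (LinearMap.range g).subtype)] at hy
    obtain ⟨z, hz⟩ := (hex y).1 (hinj hy)
    obtain ⟨w, rfl⟩ := hsurj z
    exact ⟨w, by rw [hf', hz]⟩
  · rintro ⟨w, rfl⟩
    rw [hg', hf', hex.apply_apply_eq_zero, map_zero]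

/-! ### Completed localizations -/

section LocCompl

variable {S : Type} [CommRing S] (K : Ideal S) (P : Submonoid S)

/-- The `K`-adic completion of the localization `P⁻¹ V`. -/
abbrev LocCompl (V : Type) [AddCommGroup V] [Module S V] : Type :=
  AdicCompletion (K.map (algebraMap S (Localization P))) (LocalizedModule P V)

/-- The canonical map from a module to its completed localization. -/
def toLocCompl (V : Type) [AddCommGroup V] [Module S V] : V →ₗ[S] LocCompl K P V :=
  (AdicCompletion.of _ _).restrictScalars S ∘ₗ LocalizedModule.mkLinearMap P V

/-- A module on which elements of `P` act injectively and which is `K`-adically separated. -/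
structure IsLocalHausdorff (U : Type) [AddCommGroup U] [Module S U] : Prop where
  haus : IsHausdorff K U
  inj : ∀ s ∈ P, ∀ u : U, s • u = 0 → u = 0

variable {V V' W W' U : Type} [AddCommGroup V] [Module S V] [AddCommGroup V'] [Module S V']
  [AddCommGroup W] [Module S W] [AddCommGroup W'] [Module S W'] [AddCommGroup U] [Module S U]

/-- Allows the `K`-adic filtration to be computed over any intermediate algebra, so that completions
over the localization, over `Δ⁻¹ M` and over `M^{C₃}` can all be compared over `S`. -/
theorem pow_smul_top_of_tower {T : Type} [CommRing T] [Algebra S T] [Module T V]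
    [IsScalarTower S T V] (n : ℕ) (v : V) :
    v ∈ (K.map (algebraMap S T) ^ n • ⊤ : Submodule T V) ↔ v ∈ (K ^ n • ⊤ : Submodule S V) := by
  rw [← Ideal.map_pow, ← Submodule.restrictScalars_mem S, Ideal.smul_restrictScalars]
  rfl

theorem IsLocalHausdorff.of_equiv (h : IsLocalHausdorff K P U) (e : U ≃ₗ[S] V) :
    IsLocalHausdorff K P V where
  haus := ⟨fun x hx => by
    refine e.symm.map_eq_zero_iff.1 (h.haus.haus' _ fun n => ?_)
    have := hx n
    rw [SModEq.zero] at this ⊢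
    have h2 := Submodule.mem_map_of_mem (f := (e.symm : V →ₗ[S] U)) this
    rw [Submodule.map_smul''] at h2
    exact Submodule.smul_mono le_rfl le_top h2⟩
  inj s hs u hu := e.symm.map_eq_zero_iff.1 (h.inj s hs _ (by rw [← map_smul, hu, map_zero]))

theorem isLocalHausdorff_locCompl : IsLocalHausdorff K P (LocCompl K P V) where
  haus := ⟨fun x hx => by
    refine (inferInstance : IsHausdorff (K.map (algebraMap S (Localization P)))
      (LocCompl K P V)).haus' x fun n => ?_
    have := hx n
    rw [SModEq.zero] at this ⊢
    exact (pow_smul_top_of_tower K n x).2 this⟩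
  inj s hs u hu := by
    have h : (algebraMap S (Localization P) s) • u = 0 := by rwa [algebraMap_smul]
    have hu : IsUnit (algebraMap S (Localization P) s) :=
      IsLocalization.map_units (Localization P) (⟨s, hs⟩ : P)
    exact hu.smul_eq_zero.1 h

variable {K P}

/-- Linear maps are automatically continuous for the `K`-adic topologies. Modulo `K ^ n` every
element of the completion comes from some `v / s`, and `s • h (v / s) = h v = 0` forces `h (v / s) =
0`. Only `S`-linearity of `h` is required. -/
theorem locCompl_hom_ext_zero (hK : K.FG) (hU : IsLocalHausdorff K P U) (h : LocCompl K P V →ₗ[S] U)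
    (h0 : ∀ v, h (toLocCompl K P V v) = 0) : h = 0 := by
  refine LinearMap.ext fun y => hU.haus.haus' _ fun n => ?_
  rw [SModEq.zero]
  obtain ⟨w, hw⟩ := Submodule.Quotient.mk_surjective _ (y.val n)
  -- Finite generation of `K` enters here: it makes the kernel of evaluation at level `n` equal to
  -- `K ^ n` times the completion.
  have hz : y - AdicCompletion.of _ _ w ∈ (K ^ n • ⊤ : Submodule S (LocCompl K P V)) := by
    rw [← pow_smul_top_of_tower (T := Localization P),
      AdicCompletion.pow_smul_top_eq_ker_eval (hK.map _)]
    rw [LinearMap.mem_ker, map_sub, AdicCompletion.eval_apply, ← hw, AdicCompletion.eval_of]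
    exact sub_self _
  have hw0 : h (AdicCompletion.of _ _ w) = 0 := by
    induction w using LocalizedModule.induction_on with
    | h v s =>
      refine hU.inj s s.2 _ ?_
      rw [← map_smul]
      have : (s : S) • (AdicCompletion.of (K.map (algebraMap S (Localization P))) _
          (LocalizedModule.mk v s)) = toLocCompl K P V v := by
        change AdicCompletion.of (K.map (algebraMap S (Localization P))) _
          ((s : S) • LocalizedModule.mk v s) = AdicCompletion.of _ _ (LocalizedModule.mk v 1)
        congr 1
        rw [LocalizedModule.smul'_mk]
        exact LocalizedModule.mk_cancel s v
      rw [this, h0]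
  have h1 : h y = h (y - AdicCompletion.of _ _ w) := by rw [map_sub, hw0, sub_zero]
  rw [h1]
  have h2 := Submodule.mem_map_of_mem (f := h) hz
  rw [Submodule.map_smul''] at h2
  exact Submodule.smul_mono le_rfl le_top h2

theorem locCompl_hom_ext (hK : K.FG) (hU : IsLocalHausdorff K P U) {h₁ h₂ : LocCompl K P V →ₗ[S] U}
    (h : ∀ v, h₁ (toLocCompl K P V v) = h₂ (toLocCompl K P V v)) : h₁ = h₂ :=
  sub_eq_zero.1 (locCompl_hom_ext_zero hK hU _ fun v => by
    rw [LinearMap.sub_apply, h, sub_self])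

variable (K P) in
/-- The functoriality of the completed localization. -/
def locComplMap (f : V →ₗ[S] W) : LocCompl K P V →ₗ[S] LocCompl K P W :=
  (AdicCompletion.map _ (IsLocalizedModule.mapExtendScalars P (LocalizedModule.mkLinearMap P V)
    (LocalizedModule.mkLinearMap P W) (Localization P) f)).restrictScalars
      (Localization P) |>.restrictScalars S

theorem locComplMap_toLocCompl (f : V →ₗ[S] W) (v : V) :
    locComplMap K P f (toLocCompl K P V v) = toLocCompl K P W (f v) := by
  change AdicCompletion.map _ _ (AdicCompletion.of _ _ _) = AdicCompletion.of _ _ _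
  rw [AdicCompletion.map_of]
  congr 1
  exact IsLocalizedModule.map_apply P (LocalizedModule.mkLinearMap P V) _ f v

theorem locComplMap_exact [IsNoetherianRing S] [Module.Finite S V] [Module.Finite S W]
    {f : U →ₗ[S] V} {g : V →ₗ[S] W} (h : Function.Exact f g) :
    Function.Exact (locComplMap K P f) (locComplMap K P g) := by
  have : IsNoetherianRing (Localization P) := IsLocalization.isNoetherianRing P _ inferInstance
  refine adicCompletion_map_exact _ ?_
  exact LocalizedModule.map_exact P f g h

theorem locComplMap_injective [IsNoetherianRing S] [Module.Finite S V]
    {f : U →ₗ[S] V} (h : Function.Injective f) : Function.Injective (locComplMap K P f) := by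
  have : IsNoetherianRing (Localization P) := IsLocalization.isNoetherianRing P _ inferInstance
  exact AdicCompletion.map_injective _ (IsLocalizedModule.map_injective P _ _ f h)

theorem locComplMap_surjective {f : U →ₗ[S] V} (h : Function.Surjective f) :
    Function.Surjective (locComplMap K P f) :=
  AdicCompletion.map_surjective _ (IsLocalizedModule.map_surjective P _ _ f h)

variable (K P) in
/-- The map `f : V → V'` identifies `V'` with the `K`-adic completion of `P⁻¹ V`. -/
def IsLocCompl (f : V →ₗ[S] V') : Prop :=
  ∃ e : LocCompl K P V ≃ₗ[S] V', ∀ v, e (toLocCompl K P V v) = f v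

namespace IsLocCompl

theorem isLocalHausdorff {f : V →ₗ[S] V'} (hf : IsLocCompl K P f) : IsLocalHausdorff K P V' :=
  (isLocalHausdorff_locCompl K P).of_equiv K P hf.choose

theorem hom_ext (hK : K.FG) {f : V →ₗ[S] V'} (hf : IsLocCompl K P f) (hU : IsLocalHausdorff K P U)
    {h₁ h₂ : V' →ₗ[S] U} (h : ∀ v, h₁ (f v) = h₂ (f v)) : h₁ = h₂ := by
  obtain ⟨e, he⟩ := hf
  have : h₁ ∘ₗ e = h₂ ∘ₗ (e : LocCompl K P V →ₗ[S] V') := locCompl_hom_ext hK hU fun v => by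
    simp [he, h]
  ext v
  simpa using LinearMap.congr_fun this (e.symm v)

theorem exists_equiv {f : V →ₗ[S] V'} {g : V →ₗ[S] W'} (hf : IsLocCompl K P f)
    (hg : IsLocCompl K P g) : ∃ e : V' ≃ₗ[S] W', ∀ v, e (f v) = g v := by
  obtain ⟨e, he⟩ := hf
  obtain ⟨e', he'⟩ := hg
  exact ⟨e.symm.trans e', fun v => by simp [← he, he']⟩

theorem comp_equiv {f : V →ₗ[S] V'} (hf : IsLocCompl K P f) (e : V' ≃ₗ[S] W') :
    IsLocCompl K P ((e : V' →ₗ[S] W') ∘ₗ f) := by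
  obtain ⟨e', he⟩ := hf
  exact ⟨e'.trans e, fun v => by simp [he]⟩

/-- Compatibility of the structure isomorphisms with maps. -/
theorem naturality (hK : K.FG) {f : V →ₗ[S] V'} {g : W →ₗ[S] W'} {e : LocCompl K P V ≃ₗ[S] V'}
    (he : ∀ v, e (toLocCompl K P V v) = f v) {e' : LocCompl K P W ≃ₗ[S] W'}
    (he' : ∀ v, e' (toLocCompl K P W v) = g v) {a : V →ₗ[S] W} {b : V' →ₗ[S] W'}
    (h : ∀ v, b (f v) = g (a v)) (y : LocCompl K P V) : b (e y) = e' (locComplMap K P a y) := by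
  have : b ∘ₗ e = e' ∘ₗ locComplMap K P a :=
    locCompl_hom_ext hK ((isLocalHausdorff_locCompl K P).of_equiv K P e') fun v => by
      simp [he, h, he', locComplMap_toLocCompl]
  exact LinearMap.congr_fun this y

/-- Completed localization preserves kernels of maps between finite modules, so both `Z'` and the
completed localization of `Z` are the kernel of the same map up to the isomorphisms for `V` and `W`.
-/
theorem ker (hK : K.FG) [IsNoetherianRing S] {Z Z' : Type} [AddCommGroup Z] [Module S Z]
    [AddCommGroup Z'] [Module S Z'] [Module.Finite S V] [Module.Finite S W]
    {i : Z →ₗ[S] V} {g : V →ₗ[S] W} (hi : Function.Injective i) (hex : Function.Exact i g)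
    {i' : Z' →ₗ[S] V'} {g' : V' →ₗ[S] W'} (hi' : Function.Injective i')
    (hex' : Function.Exact i' g') {φ : V →ₗ[S] V'} {ψ : W →ₗ[S] W'} {θ : Z →ₗ[S] Z'}
    (hφ : IsLocCompl K P φ) (hψ : IsLocCompl K P ψ)
    (h₁ : ∀ v, g' (φ v) = ψ (g v)) (h₂ : ∀ z, i' (θ z) = φ (i z)) : IsLocCompl K P θ := by
  obtain ⟨e, he⟩ := hφ
  obtain ⟨e', he'⟩ := hψ
  have hn (y) : g' (e y) = e' (locComplMap K P g y) := naturality hK he he' h₁ y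
  have hE := locComplMap_exact (K := K) (P := P) hex
  have hr (y : LocCompl K P Z) : e (locComplMap K P i y) ∈ LinearMap.range i' := by
    refine (hex' _).1 ?_
    rw [hn, hE.apply_apply_eq_zero, map_zero]
  let u : LocCompl K P Z →ₗ[S] Z' := (LinearEquiv.ofInjective i' hi').symm.toLinearMap ∘ₗ
    ((e : _ →ₗ[S] V') ∘ₗ locComplMap K P i).codRestrict (LinearMap.range i') hr
  have hu (y) : i' (u y) = e (locComplMap K P i y) := by
    have := LinearEquiv.apply_symm_apply (LinearEquiv.ofInjective i' hi')
      (((e : _ →ₗ[S] V') ∘ₗ locComplMap K P i).codRestrict (LinearMap.range i') hr y)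
    exact congrArg Subtype.val this
  have hbij : Function.Bijective u := by
    constructor
    · intro a b hab
      refine locComplMap_injective (K := K) (P := P) hi (e.injective ?_)
      rw [← hu, ← hu, hab]
    · intro z'
      have h0 : locComplMap K P g (e.symm (i' z')) = 0 := by
        refine e'.injective ?_
        rw [← hn, map_zero, e.apply_symm_apply, hex'.apply_apply_eq_zero]
      obtain ⟨y, hy⟩ := (hE _).1 h0
      refine ⟨y, hi' ?_⟩
      rw [hu, hy, e.apply_symm_apply]
  refine ⟨LinearEquiv.ofBijective u hbij, fun v => hi' ?_⟩
  rw [LinearEquiv.ofBijective_apply, hu, h₂, locComplMap_toLocCompl, he]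

/-- Dual to `ker`: by exactness, the surjections of the completed localizations of `V` onto that of
`Z` and onto `Z'` have the same kernel. -/
theorem coker (hK : K.FG) [IsNoetherianRing S] {Z Z' : Type} [AddCommGroup Z] [Module S Z]
    [AddCommGroup Z'] [Module S Z'] [Module.Finite S V] [Module.Finite S Z]
    {f : W →ₗ[S] V} {p : V →ₗ[S] Z} (hp : Function.Surjective p) (hex : Function.Exact f p)
    {f' : W' →ₗ[S] V'} {p' : V' →ₗ[S] Z'} (hp' : Function.Surjective p')
    (hex' : Function.Exact f' p') {φ : V →ₗ[S] V'} {ψ : W →ₗ[S] W'} {θ : Z →ₗ[S] Z'}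
    (hφ : IsLocCompl K P φ) (hψ : IsLocCompl K P ψ)
    (h₁ : ∀ w, f' (ψ w) = φ (f w)) (h₂ : ∀ v, p' (φ v) = θ (p v)) : IsLocCompl K P θ := by
  obtain ⟨e, he⟩ := hφ
  obtain ⟨e', he'⟩ := hψ
  have hn (y) : f' (e' y) = e (locComplMap K P f y) := naturality hK he' he h₁ y
  have hE := locComplMap_exact (K := K) (P := P) hex
  have hP := locComplMap_surjective (K := K) (P := P) hp
  let v : LocCompl K P V →ₗ[S] Z' := p' ∘ₗ (e : _ →ₗ[S] V')
  have hv : Function.Surjective v := hp'.comp e.surjective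
  have hker : LinearMap.ker (locComplMap K P p) = LinearMap.ker v := by
    ext y
    rw [LinearMap.mem_ker, LinearMap.mem_ker]
    refine (hE y).trans ?_
    refine Iff.trans ?_ (hex' (e y)).symm
    constructor
    · rintro ⟨w, rfl⟩
      exact ⟨e' w, hn w⟩
    · rintro ⟨w, hw⟩
      refine ⟨e'.symm w, e.injective ?_⟩
      rw [← hn, e'.apply_symm_apply, hw]
  let E := ((locComplMap K P p).quotKerEquivOfSurjective hP).symm.trans
    ((Submodule.quotEquivOfEq _ _ hker).trans (v.quotKerEquivOfSurjective hv))
  have hEv (y) : E (locComplMap K P p y) = v y := by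
    have : ((locComplMap K P p).quotKerEquivOfSurjective hP).symm (locComplMap K P p y) =
        Submodule.Quotient.mk y := by
      rw [LinearEquiv.symm_apply_eq]; rfl
    simp only [E, LinearEquiv.trans_apply, this]
    rfl
  refine ⟨E, fun z => ?_⟩
  obtain ⟨x, rfl⟩ := hp z
  rw [← locComplMap_toLocCompl, hEv, ← h₂]
  simp [v, he]

/-- Both composites of the evident maps between the completion of a power and the power of
completions are identities by `locCompl_hom_ext`, since they are so on uncompleted vectors. -/
theorem pi (hK : K.FG) {f : V →ₗ[S] V'} (hf : IsLocCompl K P f) (ι : Type) [Finite ι] :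
    IsLocCompl K P (f.compLeft ι) := by
  classical
  have := Fintype.ofFinite ι
  obtain ⟨e, he⟩ := hf
  let a : LocCompl K P (ι → V) →ₗ[S] (ι → LocCompl K P V) :=
    LinearMap.pi fun i => locComplMap K P (LinearMap.proj i)
  let b : (ι → LocCompl K P V) →ₗ[S] LocCompl K P (ι → V) :=
    ∑ i, locComplMap K P (LinearMap.single S (fun _ => V) i) ∘ₗ LinearMap.proj i
  have hba : b ∘ₗ a = LinearMap.id := by
    refine locCompl_hom_ext hK (isLocalHausdorff_locCompl K P) fun v => ?_
    simp only [a, b, LinearMap.comp_apply, LinearMap.sum_apply, LinearMap.proj_apply,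
      LinearMap.pi_apply, locComplMap_toLocCompl, ← map_sum, LinearMap.id_apply]
    congr 1
    exact LinearMap.sum_single_apply (fun _ => V) v
  have hab : a ∘ₗ b = LinearMap.id := by
    refine LinearMap.pi_ext' fun i => ?_
    refine locCompl_hom_ext hK (U := ι → LocCompl K P V) ⟨?_, ?_⟩ fun v => ?_
    · refine ⟨fun x hx => funext fun j =>
        (isLocalHausdorff_locCompl (V := V) K P).haus.haus' _ fun n => ?_⟩
      have h1 := hx n
      rw [SModEq.zero] at h1 ⊢
      have h2 := Submodule.mem_map_of_mem
        (f := (LinearMap.proj j : (ι → LocCompl K P V) →ₗ[S] _)) h1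
      rw [Submodule.map_smul''] at h2
      exact Submodule.smul_mono le_rfl le_top h2
    · exact fun s hs u hu => funext fun j =>
        (isLocalHausdorff_locCompl (V := V) K P).inj s hs _ (congrFun hu j)
    · funext j
      simp only [a, b, LinearMap.comp_apply, LinearMap.sum_apply, LinearMap.proj_apply,
        LinearMap.pi_apply, LinearMap.id_apply, LinearMap.single_apply]
      rw [Finset.sum_eq_single i]
      · rw [Pi.single_eq_same, locComplMap_toLocCompl, locComplMap_toLocCompl]
        rcases eq_or_ne j i with rfl | hj
        · simp
        · simp [hj]
      · intro k _ hk
        rw [Pi.single_eq_of_ne hk, map_zero]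
      · simp
  let E : LocCompl K P (ι → V) ≃ₗ[S] (ι → LocCompl K P V) := LinearEquiv.ofLinearMap a b hab hba
  let E' : (ι → LocCompl K P V) ≃ₗ[S] (ι → V') := LinearEquiv.piCongrRight fun _ => e
  refine ⟨E.trans E', fun v => funext fun i => ?_⟩
  change e (locComplMap K P (LinearMap.proj i) (toLocCompl K P _ v)) = f (v i)
  rw [locComplMap_toLocCompl, he, LinearMap.proj_apply]

/-- The criterion used for all three identifications: `V'` is the localization, and its `L`-adic
topology, for an ideal `L` of a possibly different ring, coincides with the `K`-adic one. -/
theorem of_topology {R : Type} [CommRing R] [Module R V'] [SMul S R] [IsScalarTower S R V']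
    (L : Ideal R) (j : V →ₗ[S] V') [IsLocalizedModule P j]
    (h : ∀ n, ∃ m, ∀ v ∈ (K ^ m • ⊤ : Submodule S V'), v ∈ (L ^ n • ⊤ : Submodule R V'))
    (h' : ∀ n, ∃ m, ∀ v ∈ (L ^ m • ⊤ : Submodule R V'), v ∈ (K ^ n • ⊤ : Submodule S V'))
    (f : V →ₗ[S] AdicCompletion L V') (hf : ∀ v, f v = AdicCompletion.of L V' (j v)) :
    IsLocCompl K P f := by
  have key {A B : Type} [AddCommGroup A] [AddCommGroup B] [Module S A] [Module S B]
      (e : A →ₗ[S] B) (n : ℕ) (v : A) (hv : v ∈ (K ^ n • ⊤ : Submodule S A)) :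
      e v ∈ (K ^ n • ⊤ : Submodule S B) := by
    have h2 := Submodule.mem_map_of_mem (f := e) hv
    rw [Submodule.map_smul''] at h2
    exact Submodule.smul_mono le_rfl le_top h2
  let g := IsLocalizedModule.iso P j
  refine ⟨complEquiv _ L g (fun n => ?_) (fun n => ?_), fun v => ?_⟩
  · obtain ⟨m, hm⟩ := h n
    exact ⟨m, fun v hv => hm _ (key g.toLinearMap m v ((pow_smul_top_of_tower K m v).1 hv))⟩
  · obtain ⟨m, hm⟩ := h' n
    exact ⟨m, fun v hv => (pow_smul_top_of_tower K n _).2 (key g.symm.toLinearMap n v (hm v hv))⟩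
  · rw [hf]
    refine (complEquiv_of _ L g _ _ _).trans ?_
    congr 1
    exact IsLocalizedModule.iso_apply_mk P j v 1 |>.trans (by simp)

/-- Completion at the zero ideal changes nothing. Thus the case `K = ⊥` of every result on
`IsLocCompl` is a statement about plain localization. -/
theorem of_isLocalizedModule (j : V →ₗ[S] V') [IsLocalizedModule P j] : IsLocCompl ⊥ P j := by
  have h : IsLocCompl ⊥ P ((AdicCompletion.of (⊥ : Ideal S) V') ∘ₗ j) :=
    of_topology ⊥ j (fun n => ⟨n, fun _ h => h⟩) (fun n => ⟨n, fun _ h => h⟩) _ fun _ => rfl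
  have h2 := h.comp_equiv (AdicCompletion.ofLinearEquiv (⊥ : Ideal S) V').symm
  convert h2
  ext v
  simp

theorem isLocalizedModule {j : V →ₗ[S] V'} (hj : IsLocCompl ⊥ P j) : IsLocalizedModule P j := by
  obtain ⟨e, he⟩ := of_isLocalizedModule (LocalizedModule.mkLinearMap P V) |>.exists_equiv hj
  have := IsLocalizedModule.of_linearEquiv P (LocalizedModule.mkLinearMap P V) e
  convert this
  ext v
  simp [← he]

end IsLocCompl

end LocCompl

/-! ### Completed localizations and homology -/

section Homology

variable {S : Type} [CommRing S] {K : Ideal S} {P : Submonoid S}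
  {ι : Type} {c : ComplexShape ι} (C D : HomologicalComplex (ModuleCat.{0} S) c) (n : ι)

theorem iCycles_injective : Function.Injective (C.iCycles n) :=
  (ModuleCat.mono_iff_injective _).1 inferInstance

theorem homologyπ_surjective : Function.Surjective (C.homologyπ n) :=
  (ModuleCat.epi_iff_surjective _).1 inferInstance

theorem iCycles_exact : Function.Exact (C.iCycles n) (C.d n (c.next n)) :=
  (ShortComplex.ShortExact.moduleCat_exact_iff_function_exact
    (ShortComplex.mk (C.iCycles n) (C.d n (c.next n)) (by simp))).1
    (ShortComplex.exact_of_f_is_kernel _ (C.cyclesIsKernel n _ rfl))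

theorem homologyπ_exact : Function.Exact (C.toCycles (c.prev n) n) (C.homologyπ n) :=
  (ShortComplex.ShortExact.moduleCat_exact_iff_function_exact
    (ShortComplex.mk (C.toCycles (c.prev n) n) (C.homologyπ n) (by simp))).1
    (ShortComplex.exact_of_g_is_cokernel _ (C.homologyIsCokernel _ n rfl))

theorem finite_cycles [IsNoetherianRing S] (h : Module.Finite S (C.X n)) :
    Module.Finite S (C.cycles n) :=
  Module.Finite.of_injective (C.iCycles n).hom (iCycles_injective C n)

theorem finite_homology [IsNoetherianRing S] (h : Module.Finite S (C.X n)) :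
    Module.Finite S (C.homology n) :=
  have := finite_cycles C n h
  Module.Finite.of_surjective (C.homologyπ n).hom (homologyπ_surjective C n)

theorem homology_smul_eq_zero (s : S) (h : ∀ v : C.X n, s • v = 0) (v : C.homology n) :
    s • v = 0 := by
  obtain ⟨z, rfl⟩ := homologyπ_surjective C n v
  have : s • z = 0 := iCycles_injective C n (by
    rw [map_zero]
    exact ((C.iCycles n).hom.map_smul s z).trans (h _))
  exact ((C.homologyπ n).hom.map_smul s z).symm.trans (by rw [this, map_zero])

variable {C D}

/-- Cycles are the kernel of a differential and homology is the cokernel of the map from the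
previous term to the cycles, so `ker` and `coker` apply in turn. -/
theorem isLocCompl_homologyMap [IsNoetherianRing S] (φ : C ⟶ D)
    (hfin : ∀ i, Module.Finite S (C.X i)) (h : ∀ i, IsLocCompl K P (φ.f i).hom) :
    IsLocCompl K P (HomologicalComplex.homologyMap φ n).hom := by
  have hK : K.FG := (isNoetherianRing_iff_ideal_fg S).1 inferInstance K
  have := finite_cycles C n (hfin n)
  have := finite_homology C n (hfin n)
  have hc : IsLocCompl K P (HomologicalComplex.cyclesMap φ n).hom := by
    refine IsLocCompl.ker hK (i := (C.iCycles n).hom) (g := (C.d n (c.next n)).hom)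
      (i' := (D.iCycles n).hom) (g' := (D.d n (c.next n)).hom) (iCycles_injective C n)
      (iCycles_exact C n) (iCycles_injective D n) (iCycles_exact D n) (h n) (h (c.next n))
      (fun v => ?_) (fun z => ?_)
    · exact ConcreteCategory.congr_hom (φ.comm n (c.next n)) v
    · exact ConcreteCategory.congr_hom (HomologicalComplex.cyclesMap_i φ n) z
  refine IsLocCompl.coker hK (p := (C.homologyπ n).hom) (f := (C.toCycles (c.prev n) n).hom)
      (p' := (D.homologyπ n).hom) (f' := (D.toCycles (c.prev n) n).hom)
      (homologyπ_surjective C n) (homologyπ_exact C n)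
      (homologyπ_surjective D n) (homologyπ_exact D n) hc (h (c.prev n))
      (fun v => ?_) (fun z => ?_)
  · have : φ.f (c.prev n) ≫ D.toCycles (c.prev n) n =
      C.toCycles (c.prev n) n ≫ HomologicalComplex.cyclesMap φ n := by
      simp [← cancel_mono (D.iCycles n)]
    exact ConcreteCategory.congr_hom this v
  · exact (ConcreteCategory.congr_hom (HomologicalComplex.homologyπ_naturality φ n) z).symm

end Homology

/-! ### Completed localizations and group cohomology -/

section Cohomology

variable {S G : Type} [CommRing S] [Group G] {K : Ideal S} {P : Submonoid S} {A B : Rep S G}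

theorem IsLocCompl.finsupp (hK : K.FG) {V V' : Type} [AddCommGroup V] [Module S V]
    [AddCommGroup V'] [Module S V'] {f : V →ₗ[S] V'} (hf : IsLocCompl K P f) (ι : Type) [Finite ι] :
    IsLocCompl K P (Finsupp.mapRange.linearMap (α := ι) f) := by
  obtain ⟨e, he⟩ := hf.pi hK ι
  let a := Finsupp.linearEquivFunOnFinite S V ι
  let a' := Finsupp.linearEquivFunOnFinite S V' ι
  let b : LocCompl K P (ι →₀ V) →ₗ[S] LocCompl K P (ι → V) := locComplMap K P a.toLinearMap
  let b' : LocCompl K P (ι → V) →ₗ[S] LocCompl K P (ι →₀ V) := locComplMap K P a.symm.toLinearMap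
  let E : LocCompl K P (ι →₀ V) ≃ₗ[S] LocCompl K P (ι → V) := LinearEquiv.ofLinearMap b b'
    (locCompl_hom_ext hK (isLocalHausdorff_locCompl K P) fun v => by
      simp [b, b', locComplMap_toLocCompl])
    (locCompl_hom_ext hK (isLocalHausdorff_locCompl K P) fun v => by
      simp [b, b', locComplMap_toLocCompl])
  refine ⟨(E.trans e).trans a'.symm, fun v => ?_⟩
  change a'.symm (e (locComplMap K P a.toLinearMap (toLocCompl K P _ v))) = _
  rw [locComplMap_toLocCompl, he]
  ext i
  rfl

variable [Finite G] [IsNoetherianRing S]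

/-- As the group is finite, each cochain module is a finite power of the coefficients. -/
theorem isLocCompl_cohMap (hA : Module.Finite S A.V) (f : A ⟶ B)
    (hf : IsLocCompl K P f.hom.toLinearMap) (p : ℕ) : IsLocCompl K P (cohMap f p) := by
  have hK : K.FG := (isNoetherianRing_iff_ideal_fg S).1 inferInstance K
  exact isLocCompl_homologyMap p _
    (fun i => inferInstanceAs (Module.Finite S ((Fin i → G) → A.V))) (fun i => hf.pi hK _)

omit [Finite G] [IsNoetherianRing S] in
theorem groupCohomology_smul_eq_zero (s : S) (h : ∀ v : A.V, s • v = 0) (p : ℕ)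
    (v : groupCohomology A p) : s • v = 0 :=
  homology_smul_eq_zero _ _ s (fun (v : (Fin p → G) → A.V) => funext fun i => h (v i)) v

end Cohomology

/-! ### Completed localizations and Tate cohomology -/

section Tate

variable {S G : Type} [CommRing S] [Group G] [Fintype G] {K : Ideal S} {P : Submonoid S}
  {A B : Rep S G}

theorem finite_tateComplex (hA : Module.Finite S A.V) (i : ℤ) :
    Module.Finite S ((tateComplex A).X i) := by
  rcases i with i | i
  · exact inferInstanceAs (Module.Finite S ((Fin i → G) → A.V))
  · exact inferInstanceAs (Module.Finite S ((Fin i → G) →₀ A.V))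

variable [IsNoetherianRing S]

theorem finite_tateCohomology (hA : Module.Finite S A.V) (q : ℤ) :
    Module.Finite S (tateCohomology A q) :=
  finite_homology _ _ (finite_tateComplex hA q)

theorem isLocCompl_tateMap (hA : Module.Finite S A.V) (f : A ⟶ B)
    (hf : IsLocCompl K P f.hom.toLinearMap) (q : ℤ) : IsLocCompl K P (tateMap q f) := by
  have hK : K.FG := (isNoetherianRing_iff_ideal_fg S).1 inferInstance K
  refine isLocCompl_homologyMap q (tateComplex.map f) (finite_tateComplex hA) fun i => ?_
  rcases i with i | i
  · exact hf.pi hK _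
  · have := hf.finsupp hK (Fin i → G)
    rw [← groupHomology.chainsMap_id_f_hom_eq_mapRange] at this
    exact this

end Tate

/-! ### Norms of linear maps act by zero on Tate cohomology -/

section Norm

/-- A homotopy in the single degree `n` is enough: the term through `X.d n j` vanishes on cycles,
and the term through `Y.d i n` lands in boundaries. -/
theorem homologyMap_eq_zero {C : Type*} [Category C] [Preadditive C] [CategoryWithHomology C]
    {ι : Type*} {c : ComplexShape ι} {X Y : HomologicalComplex C c} (φ : X ⟶ Y) {i n j : ι}
    (s : X.X j ⟶ Y.X n) (h : X.X n ⟶ Y.X i) (e : φ.f n = X.d n j ≫ s + h ≫ Y.d i n) :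
    HomologicalComplex.homologyMap φ n = 0 := by
  have hc : HomologicalComplex.cyclesMap φ n = (X.iCycles n ≫ h) ≫ Y.toCycles i n := by
    rw [← cancel_mono (Y.iCycles n), HomologicalComplex.cyclesMap_i, e]
    simp
  rw [← cancel_epi (X.homologyπ n), HomologicalComplex.homologyπ_naturality, hc]
  simp

variable {S G : Type} [CommRing S] [CommGroup G] [Fintype G]

/-- The norm `∑ g f g⁻¹` of a linear map, as a morphism of representations. -/
def normHom {X Y : Rep S G} (f : X.V →ₗ[S] Y.V) : X ⟶ Y :=
  Rep.ofHom (ρ := X.ρ) (σ := Y.ρ) ⟨∑ g : G, Y.ρ g ∘ₗ f ∘ₗ X.ρ g⁻¹, fun h => by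
    ext x
    simp only [LinearMap.comp_apply, LinearMap.sum_apply, map_sum]
    refine Fintype.sum_equiv (Equiv.mulLeft h⁻¹) _ _ fun g => ?_
    simp only [Equiv.coe_mulLeft, mul_inv_rev, inv_inv, map_mul, Module.End.mul_apply]
    rw [← Module.End.mul_apply (Y.ρ h), ← map_mul, mul_inv_cancel, map_one, Module.End.one_apply]⟩

theorem normHom_apply {X Y : Rep S G} (f : X.V →ₗ[S] Y.V) (x : X.V) :
    (normHom f).hom x = ∑ g : G, Y.ρ g (f (X.ρ g⁻¹ x)) := by
  change (∑ g : G, Y.ρ g ∘ₗ f ∘ₗ X.ρ g⁻¹) x = _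
  simp

/-- The norm is the composite of `x ↦ (g ↦ g x)`, the identification of coinduced with induced
modules for the trivial subgroup, and the extension of `f` to the induced module. This gives
vanishing wherever one of these modules is acyclic: coinduced in degrees `≥ 1`, induced in degrees
`≤ -2`. -/
theorem normHom_factors {X Y : Rep S G} (f : X.V →ₗ[S] Y.V) :
    ∃ (u : X ⟶ Rep.coind (⊥ : Subgroup G).subtype (Rep.res (⊥ : Subgroup G).subtype X))
      (w : Rep.coind (⊥ : Subgroup G).subtype (Rep.res (⊥ : Subgroup G).subtype X) ⟶
        Rep.ind (⊥ : Subgroup G).subtype (Rep.res (⊥ : Subgroup G).subtype X))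
      (v : Rep.ind (⊥ : Subgroup G).subtype (Rep.res (⊥ : Subgroup G).subtype X) ⟶ Y),
      normHom f = u ≫ w ≫ v := by
  classical
  let f' : Rep.res (⊥ : Subgroup G).subtype X ⟶ Rep.res (⊥ : Subgroup G).subtype Y :=
    Rep.ofHom (ρ := (Rep.res (⊥ : Subgroup G).subtype X).ρ)
      (σ := (Rep.res (⊥ : Subgroup G).subtype Y).ρ) ⟨f, fun g => by
        obtain rfl : g = 1 := Subsingleton.elim _ _
        rw [map_one, map_one]; rfl⟩
  refine ⟨Rep.resCoindToHom (⊥ : Subgroup G).subtype X _ (𝟙 _), (Rep.indCoindIso _).inv,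
    (Rep.indResHomEquiv (⊥ : Subgroup G).subtype _ Y).symm f', ?_⟩
  ext x
  refine (normHom_apply f x).trans ?_
  let v := (Rep.indResHomEquiv (⊥ : Subgroup G).subtype _ Y).symm f'
  have hv (g : G) (a : X.V) : v.hom (Representation.IndV.mk (⊥ : Subgroup G).subtype _ g a) =
      Y.ρ g⁻¹ (f a) := by
    simp [v]
    rfl
  let u := Rep.resCoindToHom (⊥ : Subgroup G).subtype X _ (𝟙 _)
  suffices H : ∑ g : G, Y.ρ g (f (X.ρ g⁻¹ x)) =
    v.hom (Rep.coindToInd (Rep.res (⊥ : Subgroup G).subtype X) (u.hom x)) from H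
  rw [Rep.coindToInd_apply, map_sum]
  -- Cosets of the trivial subgroup are indexed through inverses because `v` sends the class of
  -- `(g⁻¹, a)` to `g f(a)`.
  have hb : Function.Bijective (fun g : G => (Quotient.mk _ g⁻¹ :
      Quotient (QuotientGroup.rightRel (⊥ : Subgroup G)))) := by
    refine ⟨fun a b hab => ?_, fun q => ?_⟩
    · have := QuotientGroup.rightRel_apply.1 (Quotient.exact hab)
      rw [Subgroup.mem_bot] at this
      simpa [inv_mul_eq_one, eq_comm] using this
    · induction q using Quotient.inductionOn with
      | h b => exact ⟨b⁻¹, by simp⟩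
  refine Eq.trans ?_ (@Function.Bijective.sum_comp G _ Y.V _ (_) _ _ hb _)
  refine Finset.sum_congr rfl fun g _ => ?_
  refine Eq.trans ?_ (hv g⁻¹ (X.ρ g⁻¹ x)).symm
  rw [inv_inv]

/-- The homotopy is the identity `∑ g f(g⁻¹ x) = ∑ g f(g⁻¹ x - x) + ∑ g f(x)`: the first sum depends
only on the coboundary of `x`, and the second is the norm of `f(x)`. -/
theorem normHom_cochain_zero {X Y : Rep S G} (f : X.V →ₗ[S] Y.V) :
    ∃ (s : (groupCohomology.inhomogeneousCochains X).X 1 ⟶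
        (groupCohomology.inhomogeneousCochains Y).X 0)
      (h : (groupCohomology.inhomogeneousCochains X).X 0 ⟶
        (groupHomology.inhomogeneousChains Y).X 0),
      (groupCohomology.cochainsMap (MonoidHom.id G) (normHom f)).f 0 =
        (groupCohomology.inhomogeneousCochains X).d 0 1 ≫ s + h ≫ Y.tateNorm := by
  refine ⟨(groupCohomology.cochainsIso₁ X).hom ≫
      ModuleCat.ofHom (∑ g : G, Y.ρ g ∘ₗ f ∘ₗ LinearMap.proj g⁻¹) ≫
      (groupCohomology.cochainsIso₀ Y).inv,
    (groupCohomology.cochainsIso₀ X).hom ≫ ModuleCat.ofHom f ≫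
      (groupHomology.chainsIso₀ Y).inv, ?_⟩
  rw [Rep.tateNorm, ← Category.assoc _ (groupCohomology.cochainsIso₁ X).hom,
    ← groupCohomology.comp_d₀₁_eq, ← cancel_mono (groupCohomology.cochainsIso₀ Y).hom,
    groupCohomology.cochainsMap_f_0_comp_cochainsIso₀]
  simp only [Preadditive.add_comp, Category.assoc, Iso.inv_hom_id, Category.comp_id,
    Iso.inv_hom_id_assoc]
  rw [← Preadditive.comp_add]
  congr 1
  ext x
  refine (normHom_apply f x).trans ?_
  simp [Representation.norm]

/-- Here the identity is `∑ g f(g⁻¹ x) = f(∑ g x) + ∑ (g f(g⁻¹ x) - f(g⁻¹ x))`, whose last sum is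
the boundary of the 1-chain with value `f(g⁻¹ x)` at `g⁻¹`. -/
theorem normHom_chain_zero {X Y : Rep S G} (f : X.V →ₗ[S] Y.V) :
    ∃ (s : (groupCohomology.inhomogeneousCochains X).X 0 ⟶
        (groupHomology.inhomogeneousChains Y).X 0)
      (h : (groupHomology.inhomogeneousChains X).X 0 ⟶
        (groupHomology.inhomogeneousChains Y).X 1),
      (groupHomology.chainsMap (MonoidHom.id G) (normHom f)).f 0 =
        X.tateNorm ≫ s + h ≫ (groupHomology.inhomogeneousChains Y).d 1 0 := by
  refine ⟨(groupCohomology.cochainsIso₀ X).hom ≫ ModuleCat.ofHom f ≫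
      (groupHomology.chainsIso₀ Y).inv,
    (groupHomology.chainsIso₀ X).hom ≫
      ModuleCat.ofHom (∑ g : G, Finsupp.lsingle g⁻¹ ∘ₗ f ∘ₗ X.ρ g⁻¹) ≫
      (groupHomology.chainsIso₁ Y).inv, ?_⟩
  rw [Rep.tateNorm, Category.assoc, Category.assoc, Category.assoc, Category.assoc,
    groupHomology.eq_d₁₀_comp_inv,
    ← cancel_mono (groupHomology.chainsIso₀ Y).hom,
    groupHomology.chainsMap_f_0_comp_chainsIso₀]
  simp only [Preadditive.add_comp, Category.assoc, Iso.inv_hom_id, Category.comp_id,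
    Iso.inv_hom_id_assoc]
  rw [← Preadditive.comp_add]
  congr 1
  ext x
  refine (normHom_apply f x).trans ?_
  have h (g : G) (a : Y.V) : (groupHomology.d₁₀ Y).hom (Finsupp.single g⁻¹ a) = Y.ρ g a - a := by
    rw [groupHomology.d₁₀_single, inv_inv]
  change _ = f (X.ρ.norm x) + (groupHomology.d₁₀ Y).hom
    ((∑ g : G, Finsupp.lsingle g⁻¹ ∘ₗ f ∘ₗ X.ρ g⁻¹) x)
  simp only [LinearMap.sum_apply, LinearMap.comp_apply, map_sum, Finsupp.lsingle_apply, h,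
    Finset.sum_sub_distrib, Representation.norm]
  rw [← Equiv.sum_comp (Equiv.inv G) fun g => f (X.ρ g x)]
  simp

theorem tateMap_normHom_zero {X Y : Rep S G} (f : X.V →ₗ[S] Y.V) :
    tateMap 0 (normHom f) = 0 := by
  obtain ⟨s, h, e⟩ : ∃ (s : (tateComplex X).X 1 ⟶ (tateComplex Y).X 0)
      (h : (tateComplex X).X 0 ⟶ (tateComplex Y).X (-1)),
      (tateComplex.map (normHom f)).f 0 =
        (tateComplex X).d 0 1 ≫ s + h ≫ (tateComplex Y).d (-1) 0 :=
    normHom_cochain_zero f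
  exact congrArg ModuleCat.Hom.hom (homologyMap_eq_zero _ s h e)

theorem tateMap_normHom_neg_one {X Y : Rep S G} (f : X.V →ₗ[S] Y.V) :
    tateMap (-1) (normHom f) = 0 := by
  obtain ⟨s, h, e⟩ : ∃ (s : (tateComplex X).X 0 ⟶ (tateComplex Y).X (-1))
      (h : (tateComplex X).X (-1) ⟶ (tateComplex Y).X (-2)),
      (tateComplex.map (normHom f)).f (-1) =
        (tateComplex X).d (-1) 0 ≫ s + h ≫ (tateComplex Y).d (-2) (-1) :=
    normHom_chain_zero f
  exact congrArg ModuleCat.Hom.hom (homologyMap_eq_zero _ s h e)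

theorem tateMap_normHom {X Y : Rep S G} (f : X.V →ₗ[S] Y.V) (q : ℤ) :
    tateMap q (normHom f) = 0 := by
  obtain ⟨u, w, v, h⟩ := normHom_factors f
  -- The cases are `q = 0`, `q ≥ 1`, `q = -1` and `q ≤ -2`; the two middle degrees are those not
  -- covered by acyclicity.
  rcases q with (_ | n) | (_ | n)
  · exact tateMap_normHom_zero f
  · rw [h, tateMap_comp]
    have : tateMap (Int.ofNat (n + 1)) u = 0 :=
      congrArg ModuleCat.Hom.hom ((isZero_coind _ n).eq_of_tgt _ 0)
    rw [this, LinearMap.comp_zero]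
  · exact tateMap_normHom_neg_one f
  · rw [h, tateMap_comp, tateMap_comp]
    have : tateMap (Int.negSucc (n + 1)) v = 0 :=
      congrArg ModuleCat.Hom.hom ((isZero_ind _ n _ (Int.negSucc_eq _)).eq_of_src _ 0)
    rw [this, LinearMap.zero_comp, LinearMap.zero_comp]

end Norm

/-! ### Finiteness -/

section Noetherian

/-- `M` is integral over the invariants of a finite group and of finite type over `𝕎`. -/
instance : Module.Finite (inv act ⊤) M := by
  let _ : MulSemiringAction C9 M :=
    { smul g m := act g m
      one_smul m := by change act 1 m = m; rw [map_one]; rfl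
      mul_smul g h m := by change act (g * h) m = act g (act h m); rw [map_mul]; rfl
      smul_zero g := map_zero (act g)
      smul_add g := map_add (act g)
      smul_one g := map_one (act g)
      smul_mul g := map_mul (act g) }
  have : Algebra.IsInvariant (inv act ⊤) M C9 := ⟨fun m hm => ⟨⟨m, fun g _ => hm g⟩, rfl⟩⟩
  have : Algebra.IsIntegral (inv act ⊤) M := Algebra.IsInvariant.isIntegral (inv act ⊤) M C9
  have : Algebra.FiniteType W M := Algebra.FiniteType.of_surjective toM toM_surjective
  have : Algebra.FiniteType (inv act ⊤) M := Algebra.FiniteType.of_restrictScalars_finiteType W _ _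
  exact Algebra.IsIntegral.finite

/-- The Artin–Tate lemma makes `M^{C₉}` of finite type over the noetherian ring `𝕎`. -/
instance : IsNoetherianRing (inv act ⊤) := by
  have h1 : Algebra.FiniteType W M := Algebra.FiniteType.of_surjective toM toM_surjective
  have h2 : Algebra.FiniteType W (inv act ⊤) := ⟨fg_of_fg_of_fg W (inv act ⊤) M h1.out
    Module.Finite.fg_top Subtype.val_injective⟩
  exact Algebra.FiniteType.isNoetherianRing W _

end Noetherian

/-! ### Traces act by zero on Tate cohomology -/

section Trace

variable {k A G : Type} [CommRing k] [CommRing A] [Algebra k A] [CommGroup G]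
  (φ : G →* (A →ₐ[k] A)) (H : Subgroup G) [Fintype H]

/-- Multiplication by the trace of `a` is the norm of the linear map "multiply by `a`", because `(∑
h a) m = ∑ h (a · h⁻¹ m)` for `h` in `H`. -/
theorem tateScalar_trace (q : ℤ) (a : A) (b : inv φ H) (hb : (b : A) = ∑ h : H, φ h a) :
    tateScalar φ H q b = 0 := by
  have key (m : A) : (b : A) * m = ∑ h : H, φ h (a * φ (h⁻¹ : H) m) := by
    rw [hb, Finset.sum_mul]
    refine Finset.sum_congr rfl fun h _ => ?_
    rw [map_mul, ← AlgHom.mul_apply, ← map_mul, ← Subgroup.coe_mul, mul_inv_cancel,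
      Subgroup.coe_one, map_one]
    rfl
  have : mulHom φ H b = normHom (X := Rep.res H.subtype (ringRep φ))
      (Y := Rep.res H.subtype (ringRep φ))
      (LinearMap.mulLeft (inv φ ⊤) a : A →ₗ[inv φ ⊤] A) := by
    ext m
    refine Eq.trans ?_ (normHom_apply (X := Rep.res H.subtype (ringRep φ))
      (Y := Rep.res H.subtype (ringRep φ))
      (LinearMap.mulLeft (inv φ ⊤) a : A →ₗ[inv φ ⊤] A) m).symm
    exact key m
  change tateMap q (mulHom φ H b) = 0
  rw [this]
  exact tateMap_normHom _ q

theorem locTate_smul_eq_zero (t : inv φ ⊤) (q : ℤ) (b : inv φ H) (hb : tateScalar φ H q b = 0)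
    (v : LocTateMod φ H t q) : b • v = 0 := by
  rw [locTate_smul_def]
  change locEnd (Submonoid.powers t) (tateScalar φ H q b) v = 0
  rw [hb, map_zero]
  rfl

end Trace

theorem pow_sup_smul_top {R V : Type} [CommRing R] [AddCommGroup V] [Module R V] (J a : Ideal R)
    (ha : ∀ r ∈ a, ∀ v : V, r • v = 0) (n : ℕ) :
    ((J ⊔ a) ^ n • ⊤ : Submodule R V) = J ^ n • ⊤ := by
  induction n with
  | zero => simp
  | succ n ih =>
    have h : a • (J ^ n • ⊤ : Submodule R V) = ⊥ :=
      le_bot_iff.1 (Submodule.smul_le.2 fun r hr v _ => ha r hr v)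
    rw [pow_succ', Submodule.mul_smul, ih, Submodule.sup_smul, h, sup_bot_eq, ← Submodule.mul_smul,
      ← pow_succ']

/-! ### Invariant elements of `M` -/

section Elements

theorem C3_cases {g : C9} (hg : g ∈ C3) : g = 1 ∨ g = γ ^ 3 ∨ g = γ ^ 6 := by
  obtain ⟨n, rfl⟩ := mem_powers_iff_mem_zpowers.2 hg
  have h : (γ ^ 3) ^ n = (γ ^ 3) ^ (n % 3) := by
    conv_lhs => rw [← Nat.div_add_mod n 3, pow_add, pow_mul]
    have : ((γ ^ 3) ^ 3 : C9) = 1 := by decide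
    rw [this, one_pow, one_mul]
  have h3 : n % 3 < 3 := Nat.mod_lt _ (by norm_num)
  dsimp only
  rw [h]
  interval_cases n % 3
  · exact Or.inl rfl
  · exact Or.inr (Or.inl rfl)
  · exact Or.inr (Or.inr rfl)

theorem sum_C3 (f : C9 → M) : ∑ h : C3, f h = f 1 + f (γ ^ 3) + f (γ ^ 6) := by
  classical
  have h3 : γ ^ 3 ∈ C3 := Subgroup.mem_zpowers _
  have h6 : γ ^ 6 ∈ C3 := by
    have : γ ^ 6 = (γ ^ 3) ^ 2 := rfl
    rw [this]; exact C3.pow_mem h3 2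
  have hu : (Finset.univ : Finset C3) = {1, ⟨γ ^ 3, h3⟩, ⟨γ ^ 6, h6⟩} := by
    ext ⟨g, hg⟩
    simpa [Subtype.ext_iff] using C3_cases hg
  rw [hu, Finset.sum_insert, Finset.sum_insert, Finset.sum_singleton, add_assoc]
  · rfl
  · rw [Finset.mem_singleton, Subtype.mk.injEq]; decide
  · rw [Finset.mem_insert, Finset.mem_singleton, Subtype.ext_iff, Subtype.ext_iff]
    change ¬ ((1 : C9) = γ ^ 3 ∨ (1 : C9) = γ ^ 6)
    decide

theorem three_cases {f : ZMod 9 → M} (hf : ∀ j, f (j + 3) = f j) (j : ZMod 9) :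
    f j = f 0 ∨ f j = f 1 ∨ f j = f 2 := by
  have h3 : f 3 = f 0 := hf 0
  have h4 : f 4 = f 1 := hf 1
  have h5 : f 5 = f 2 := hf 2
  have h6 : f 6 = f 0 := (hf 3).trans h3
  have h7 : f 7 = f 1 := (hf 4).trans h4
  have h8 : f 8 = f 2 := (hf 5).trans h5
  fin_cases j
  · exact Or.inl rfl
  · exact Or.inr (Or.inl rfl)
  · exact Or.inr (Or.inr rfl)
  · exact Or.inl h3
  · exact Or.inr (Or.inl h4)
  · exact Or.inr (Or.inr h5)
  · exact Or.inl h6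
  · exact Or.inr (Or.inl h7)
  · exact Or.inr (Or.inr h8)

/-- The trace `x_j x_{j+3} + x_{j+3} x_{j+6} + x_{j+6} x_j` of `x_j x_{j+3}`. -/
def eM (j : ZMod 9) : M := x j * x (j + 3) + x (j + 3) * x (j + 6) + x (j + 6) * x j

theorem act_eM (g : C9) (j : ZMod 9) : act g (eM j) = eM (j + g.toAdd) := by
  simp only [eM, map_mul, map_add, act_x, add_right_comm]

theorem eM_add_three (j : ZMod 9) : eM (j + 3) = eM j := by
  have h1 : j + 3 + 3 = j + 6 := by rw [add_assoc]; rfl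
  have h2 : j + 3 + 6 = j := by
    rw [add_assoc, show (3 + 6 : ZMod 9) = 0 from rfl, add_zero]
  rw [eM, eM, h1, h2]; ring

theorem eM_eq_trace (j : ZMod 9) : eM j = ∑ h : C3, act h (x j * x (j + 3)) := by
  rw [sum_C3 fun g => act g (x j * x (j + 3))]
  simp only [map_mul, act_x]
  have h3 : (γ ^ 3).toAdd = 3 := rfl
  have h6 : (γ ^ 6).toAdd = 6 := rfl
  have h33 : j + 3 + 3 = j + 6 := by rw [add_assoc]; rfl
  have h36 : j + 3 + 6 = j := by
    rw [add_assoc, show (3 + 6 : ZMod 9) = 0 from rfl, add_zero]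
  rw [h3, h6, toAdd_one, add_zero, add_zero, h33, h36, eM]

theorem eM_mem (j : ZMod 9) : eM j ∈ inv act C3 := fun g hg => by
  rw [act_eM]
  rcases C3_cases hg with rfl | rfl | rfl
  · rw [toAdd_one, add_zero]
  · exact eM_add_three j
  · have : j + (γ ^ 6).toAdd = j + 3 + 3 := by rw [add_assoc]; rfl
    rw [this, eM_add_three, eM_add_three]

/-- The trace `eM j` as an element of `M^{C₃}`. -/
def eInv (j : ZMod 9) : inv act C3 := ⟨eM j, eM_mem j⟩

theorem mem_inv_top {a : M} (f : ZMod 9 → M) (h0 : f 0 = a) (hact : ∀ g, act g a = f g.toAdd)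
    (hf : ∀ j, f (j + 1) = f j) : a ∈ inv act ⊤ := fun g _ => by
  rw [hact, const_of_add_one f hf, h0]

theorem eM_shift (a : ZMod 9) : eM (0 + (a + 1)) = eM (1 + a) ∧ eM (1 + (a + 1)) = eM (2 + a) ∧
    eM (2 + (a + 1)) = eM (0 + a) := by
  have h0 : (0 + (a + 1) : ZMod 9) = 1 + a := by ring
  have h1 : (1 + (a + 1) : ZMod 9) = 2 + a := by ring
  have h2 : (2 + (a + 1) : ZMod 9) = 0 + a + 3 := by ring
  rw [h0, h1, h2, eM_add_three]
  exact ⟨rfl, rfl, rfl⟩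

/-- The first elementary symmetric function of the traces. -/
def σ₁ : inv act ⊤ := ⟨eM 0 + eM 1 + eM 2,
  mem_inv_top (fun a => eM (0 + a) + eM (1 + a) + eM (2 + a)) (by simp)
    (fun g => by simp only [map_add, act_eM]) (fun a => by
      obtain ⟨h0, h1, h2⟩ := eM_shift a
      simp only [h0, h1, h2]; ring)⟩

/-- The second elementary symmetric function of the traces. -/
def σ₂ : inv act ⊤ := ⟨eM 0 * eM 1 + eM 1 * eM 2 + eM 2 * eM 0,
  mem_inv_top (fun a => eM (0 + a) * eM (1 + a) + eM (1 + a) * eM (2 + a) + eM (2 + a) * eM (0 + a))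
    (by simp) (fun g => by simp only [map_add, map_mul, act_eM]) (fun a => by
      obtain ⟨h0, h1, h2⟩ := eM_shift a
      simp only [h0, h1, h2]; ring)⟩

/-- The third elementary symmetric function of the traces. -/
def σ₃ : inv act ⊤ := ⟨eM 0 * eM 1 * eM 2,
  mem_inv_top (fun a => eM (0 + a) * eM (1 + a) * eM (2 + a))
    (by simp) (fun g => by simp only [map_mul, act_eM]) (fun a => by
      obtain ⟨h0, h1, h2⟩ := eM_shift a
      simp only [h0, h1, h2]; ring)⟩

/-- The ideal of `M^{C₉}` generated by `3` and the symmetric functions of the traces. -/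
def traceIdeal : Ideal (inv act ⊤) := Ideal.span {3, σ₁, σ₂, σ₃}

/-- An ideal of `M^{C₉}` that defines the `I`-adic topology of `M`. -/
def K : Ideal (inv act ⊤) := Ideal.span {s₁, s₂} ⊔ traceIdeal

theorem x_relation (j : ZMod 9) : x j + x (j + 3) + x (j + 6) = 0 := by
  have : toM (MvPolynomial.X j + MvPolynomial.X (j + 3) + MvPolynomial.X (j + 6)) = 0 :=
    Ideal.Quotient.eq_zero_iff_mem.2 (Ideal.subset_span ⟨j, rfl⟩)
  simpa [x] using this

/-- `x_j` is a root of `∏ (T - x_{j+3i})`, whose quadratic term vanishes by the defining relation of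
`M`. -/
theorem x_cubic (j : ZMod 9) : x j ^ 3 + eM j * x j - dM j = 0 := by
  have h := x_relation j
  rw [eM, dM]
  linear_combination x j ^ 2 * h

theorem mem_radical_of_cube {R : Type} [CommRing R] {I : Ideal R} {a : R} (h : a ^ 3 ∈ I.radical) :
    a ∈ I.radical :=
  (Ideal.radical_isRadical I) ⟨3, h⟩

theorem eM_cubic (j : ZMod 9) : eM j ^ 3 = σ₁.1 * eM j ^ 2 - σ₂.1 * eM j + σ₃.1 := by
  simp only [σ₁, σ₂, σ₃]
  rcases three_cases eM_add_three j with h | h | h <;> rw [h] <;> ring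

theorem dM_cubic (j : ZMod 9) :
    dM j ^ 3 = s₁.1 * dM j ^ 2 - s₂.1 * dM j + dM 0 * dM 1 * dM 2 := by
  simp only [s₁, s₂]
  rcases three_cases dM_add_three j with h | h | h <;> rw [h] <;> ring

theorem s₁_mem_K : s₁ ∈ K := le_sup_left (a := Ideal.span {s₁, s₂}) (Ideal.subset_span (by simp))
theorem s₂_mem_K : s₂ ∈ K := le_sup_left (a := Ideal.span {s₁, s₂}) (Ideal.subset_span (by simp))
theorem three_mem_K : 3 ∈ K := le_sup_right (b := traceIdeal) (Ideal.subset_span (by simp))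
theorem σ₁_mem_K : σ₁ ∈ K := le_sup_right (b := traceIdeal) (Ideal.subset_span (by simp))
theorem σ₂_mem_K : σ₂ ∈ K := le_sup_right (b := traceIdeal) (Ideal.subset_span (by simp))
theorem σ₃_mem_K : σ₃ ∈ K := le_sup_right (b := traceIdeal) (Ideal.subset_span (by simp))

/-- Modulo the radical, each `e_j` vanishes, being a root of a monic cubic whose lower coefficients
lie in `K`. The `d_j` are roots of one cubic with `s₁ = s₂ = 0`, so their cubes agree; since `3 =
0`, cubing is additive and the `d_j` agree. Then `x_j³ = d_j`, and the same argument shows that the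
`x_j` agree. -/
theorem I_le_radical : I ≤ (K.map (algebraMap (inv act ⊤) M)).radical := by
  set P := (K.map (algebraMap (inv act ⊤) M)).radical with hP
  have hK {s : inv act ⊤} (hs : s ∈ K) : s.1 ∈ P := Ideal.le_radical (Ideal.mem_map_of_mem _ hs)
  have h3 : (3 : M) ∈ P := hK three_mem_K
  have he (j : ZMod 9) : eM j ∈ P := mem_radical_of_cube (by
    rw [eM_cubic]
    exact add_mem (sub_mem (P.mul_mem_right _ (hK σ₁_mem_K)) (P.mul_mem_right _ (hK σ₂_mem_K)))
      (hK σ₃_mem_K))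
  have hd (i j : ZMod 9) : dM i - dM j ∈ P := mem_radical_of_cube (by
    have : (dM i - dM j) ^ 3 = s₁.1 * (dM i ^ 2 - dM j ^ 2) - s₂.1 * (dM i - dM j) -
        3 * (dM i * dM j * (dM i - dM j)) := by
      linear_combination dM_cubic i - dM_cubic j
    rw [this]
    exact sub_mem (sub_mem (P.mul_mem_right _ (hK s₁_mem_K)) (P.mul_mem_right _ (hK s₂_mem_K)))
      (P.mul_mem_right _ h3))
  refine Ideal.span_le.2 ?_
  rintro _ (rfl | ⟨i, rfl⟩)
  · exact h3
  · refine mem_radical_of_cube ?_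
    have : (x i - x (i + 1)) ^ 3 = (dM i - dM (i + 1)) - eM i * x i + eM (i + 1) * x (i + 1) -
        3 * (x i * x (i + 1) * (x i - x (i + 1))) := by
      linear_combination x_cubic i - x_cubic (i + 1)
    rw [this]
    exact sub_mem (add_mem (sub_mem (hd _ _) (P.mul_mem_right _ (he _)))
      (P.mul_mem_right _ (he _))) (P.mul_mem_right _ h3)

/-- Modulo `I` all variables equal one `x` and `3 = 0`, so `e_j = 3x² = 0`, `s₁ = 3x³ = 0` and `s₂ =
3x⁶ = 0`. -/
theorem K_map_le : K.map (algebraMap (inv act ⊤) M) ≤ I := by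
  have hx (j : ZMod 9) : Ideal.Quotient.mk I (x j) = Ideal.Quotient.mk I (x 0) :=
    const_of_add_one (fun j => Ideal.Quotient.mk I (x j)) (fun a => by
      refine (Ideal.Quotient.eq.2 ?_).symm
      exact Ideal.subset_span (Set.mem_insert_of_mem _ ⟨a, rfl⟩)) j
  have h3 : (3 : M ⧸ I) = 0 :=
    Ideal.Quotient.eq_zero_iff_mem.2 (Ideal.subset_span (Set.mem_insert _ _))
  have he (j : ZMod 9) : Ideal.Quotient.mk I (eM j) = 0 := by
    simp only [eM, map_add, map_mul]
    rw [hx, hx (j + 3), hx (j + 6)]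
    linear_combination Ideal.Quotient.mk I (x 0) ^ 2 * h3
  have hd (j : ZMod 9) : Ideal.Quotient.mk I (dM j) = Ideal.Quotient.mk I (x 0) ^ 3 := by
    simp only [dM, map_mul]
    rw [hx, hx (j + 3), hx (j + 6)]
    ring
  have hI {s : inv act ⊤} (h : Ideal.Quotient.mk I s.1 = 0) :
      s ∈ Ideal.comap (algebraMap (inv act ⊤) M) I :=
    (Ideal.Quotient.eq_zero_iff_mem (I := I)).1 h
  rw [Ideal.map_le_iff_le_comap]
  refine sup_le (Ideal.span_le.2 ?_) (Ideal.span_le.2 ?_)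
  · rintro _ (rfl | rfl)
    · refine hI ?_
      change Ideal.Quotient.mk I (dM 0 + dM 1 + dM 2) = 0
      simp only [map_add, hd]
      linear_combination Ideal.Quotient.mk I (x 0) ^ 3 * h3
    · refine hI ?_
      change Ideal.Quotient.mk I (dM 0 * dM 1 + dM 1 * dM 2 + dM 2 * dM 0) = 0
      simp only [map_add, map_mul, hd]
      linear_combination Ideal.Quotient.mk I (x 0) ^ 6 * h3
  · rintro _ (rfl | rfl | rfl | rfl) <;> refine hI ?_
    · exact h3
    · change Ideal.Quotient.mk I (eM 0 + eM 1 + eM 2) = 0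
      simp [he]
    · change Ideal.Quotient.mk I (eM 0 * eM 1 + eM 1 * eM 2 + eM 2 * eM 0) = 0
      simp [he]
    · change Ideal.Quotient.mk I (eM 0 * eM 1 * eM 2) = 0
      simp [he]

/-- The ideal of `M^{C₃}` generated by `3` and the traces. -/
def traceIdeal₃ : Ideal (inv act C3) := Ideal.span (insert 3 (Set.range eInv))

theorem tateScalar_of_mem (q : ℤ) {b : inv act C3} (hb : b ∈ traceIdeal₃) :
    tateScalar act C3 q b = 0 := by
  have : traceIdeal₃ ≤ RingHom.ker (tateScalar act C3 q) := by
    refine Ideal.span_le.2 ?_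
    rintro _ (rfl | ⟨j, rfl⟩)
    -- `3` is the trace of `1`.
    · refine tateScalar_trace act C3 q 1 3 ?_
      rw [sum_C3 fun g => act g 1]
      simp only [map_one]
      change (3 : M) = _
      norm_num
    · exact tateScalar_trace act C3 q _ _ (eM_eq_trace j)
  exact this hb

theorem traceIdeal_map_le : traceIdeal.map (algebraMap (inv act ⊤) (inv act C3)) ≤ traceIdeal₃ := by
  have he (j : ZMod 9) : eInv j ∈ traceIdeal₃ :=
    Ideal.subset_span (Set.mem_insert_of_mem _ ⟨j, rfl⟩)
  rw [Ideal.map_le_iff_le_comap]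
  refine Ideal.span_le.2 ?_
  rintro _ (rfl | rfl | rfl | rfl)
  · exact Ideal.subset_span (Set.mem_insert _ _)
  · exact add_mem (add_mem (he 0) (he 1)) (he 2)
  · exact add_mem (add_mem (Ideal.mul_mem_right (eInv 1) _ (he 0))
      (Ideal.mul_mem_right (eInv 2) _ (he 1))) (Ideal.mul_mem_right (eInv 0) _ (he 2))
  · exact Ideal.mul_mem_right (eInv 2) _ (Ideal.mul_mem_right (eInv 1) _ (he 0))

/-- Expanding around `d 0`, the elements `s₁` and `s₂` become `3 d₁` and `3 d₁²` modulo `J`. -/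
theorem K_map_le_J : K.map (algebraMap (inv act ⊤) (inv act C3)) ≤ J ⊔ traceIdeal₃ := by
  rw [K, Ideal.map_sup]
  refine sup_le ?_ (traceIdeal_map_le.trans le_sup_right)
  have h1 : d 0 - d 1 ∈ J ⊔ traceIdeal₃ := le_sup_left (a := J) (d_sub_mem 1)
  have h2 : d 0 - d 2 ∈ J ⊔ traceIdeal₃ := le_sup_left (a := J) (d_sub_mem 2)
  have h3 : (3 : inv act C3) ∈ J ⊔ traceIdeal₃ :=
    le_sup_right (b := traceIdeal₃) (Ideal.subset_span (Set.mem_insert _ _))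
  rw [Ideal.map_le_iff_le_comap]
  refine Ideal.span_le.2 ?_
  rintro _ (rfl | rfl)
  · have : algebraMap (inv act ⊤) (inv act C3) s₁ =
      3 * d 0 - (d 0 - d 1) - (d 0 - d 2) := by
      have : algebraMap (inv act ⊤) (inv act C3) s₁ = d 0 + d 1 + d 2 := rfl
      rw [this]; ring
    change algebraMap (inv act ⊤) (inv act C3) s₁ ∈ J ⊔ traceIdeal₃
    rw [this]
    exact sub_mem (sub_mem (Ideal.mul_mem_right _ _ h3) h1) h2
  · have : algebraMap (inv act ⊤) (inv act C3) s₂ =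
      3 * d 0 ^ 2 - (d 0 - d 1) * (2 * d 0) - (d 0 - d 2) * (2 * d 0) +
        (d 0 - d 1) * (d 0 - d 2) := by
      have : algebraMap (inv act ⊤) (inv act C3) s₂ = d 0 * d 1 + d 1 * d 2 + d 2 * d 0 := rfl
      rw [this]; ring
    change algebraMap (inv act ⊤) (inv act C3) s₂ ∈ J ⊔ traceIdeal₃
    rw [this]
    exact add_mem (sub_mem (sub_mem (Ideal.mul_mem_right _ _ h3) (Ideal.mul_mem_right _ _ h1))
      (Ideal.mul_mem_right _ _ h2)) (Ideal.mul_mem_right _ _ h1)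

theorem J_le_radical :
    J ≤ (K.map (algebraMap (inv act ⊤) (inv act C3)) ⊔ traceIdeal₃).radical := by
  set P := (K.map (algebraMap (inv act ⊤) (inv act C3)) ⊔ traceIdeal₃).radical with hP
  have hK {s : inv act ⊤} (hs : s ∈ K) : algebraMap (inv act ⊤) (inv act C3) s ∈ P :=
    Ideal.le_radical (le_sup_left (b := traceIdeal₃) (Ideal.mem_map_of_mem _ hs))
  have h3 : (3 : inv act C3) ∈ P := hK three_mem_K
  have hd (i j : ZMod 9) : d i - d j ∈ P := mem_radical_of_cube (by
    have : (d i - d j) ^ 3 = algebraMap _ _ s₁ * (d i ^ 2 - d j ^ 2) -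
        algebraMap _ _ s₂ * (d i - d j) - 3 * (d i * d j * (d i - d j)) := Subtype.ext (by
      change (dM i - dM j) ^ 3 = s₁.1 * (dM i ^ 2 - dM j ^ 2) - s₂.1 * (dM i - dM j) -
        3 * (dM i * dM j * (dM i - dM j))
      linear_combination dM_cubic i - dM_cubic j)
    rw [this]
    exact sub_mem (sub_mem (P.mul_mem_right _ (hK s₁_mem_K)) (P.mul_mem_right _ (hK s₂_mem_K)))
      (P.mul_mem_right _ h3))
  refine Ideal.span_le.2 ?_
  rintro _ (rfl | rfl)
  · exact hd _ _
  · exact hd _ _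

end Elements

/-! ### The three modules as completed localizations of `E₂` -/

theorem finite_N (q : ℤ) : Module.Finite (inv act ⊤) (N act C3 q).V :=
  finite_tateCohomology (A := Rep.res C3.subtype (ringRep act))
    (inferInstanceAs (Module.Finite (inv act ⊤) M)) q

theorem isLocCompl_toComplRing :
    IsLocCompl K (Submonoid.powers Δ) (toComplRing act Δ I I_stable).hom.toLinearMap := by
  have h1 : IsLocalization (Algebra.algebraMapSubmonoid M (Submonoid.powers Δ)) (Loc act Δ) := by
    rw [Algebra.algebraMapSubmonoid_powers]
    exact inferInstanceAs (IsLocalization.Away (Δ : M) (Localization.Away (Δ : M)))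
  have h2 : IsLocalizedModule (Submonoid.powers Δ)
      (IsScalarTower.toAlgHom (inv act ⊤) M (Loc act Δ)).toLinearMap :=
    isLocalizedModule_iff_isLocalization.2 h1
  have hmap : K.map (algebraMap (inv act ⊤) (Loc act Δ)) =
      (K.map (algebraMap (inv act ⊤) M)).map (algebraMap M (Loc act Δ)) := by
    rw [Ideal.map_map, ← IsScalarTower.algebraMap_eq]
  -- Since `I` is finitely generated, some power `I ^ m` lies in `K M`; hence `I ^ (m * n)` lies in
  -- `K ^ n M`.
  obtain ⟨m, hm⟩ := Ideal.exists_pow_le_of_le_radical_of_fg I_le_radical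
    (Submodule.fg_span (Set.toFinite _))
  refine IsLocCompl.of_topology (V := M) (I.map (algebraMap M (Loc act Δ)))
    (IsScalarTower.toAlgHom (inv act ⊤) M (Loc act Δ)).toLinearMap (fun n => ⟨n, fun v hv => ?_⟩)
    (fun n => ⟨m * n, fun v hv => ?_⟩) _ fun v => rfl
  · rw [← pow_smul_top_of_tower (T := Loc act Δ), hmap] at hv
    exact Submodule.smul_mono (Ideal.pow_right_mono (Ideal.map_mono K_map_le) n) le_rfl hv
  · rw [← pow_smul_top_of_tower (T := Loc act Δ), hmap]
    refine Submodule.smul_mono ?_ le_rfl hv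
    rw [pow_mul, ← Ideal.map_pow]
    exact Ideal.pow_right_mono (Ideal.map_mono hm) n

theorem isLocCompl_tateRepMap (q : ℤ) : IsLocCompl K (Submonoid.powers Δ)
    (tateRepMap C3 q (toComplRing act Δ I I_stable)).hom.toLinearMap :=
  isLocCompl_tateMap (A := Rep.res C3.subtype (ringRep act))
    (inferInstanceAs (Module.Finite (inv act ⊤) M)) _ isLocCompl_toComplRing q

/-- `traceIdeal₃` annihilates `Δ⁻¹ N^q`, so adding it to `J` or to `K M^{C₃}` leaves the filtrations
unchanged, and the enlarged ideals define the same topology. -/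
theorem isLocCompl_toComplN (q : ℤ) : IsLocCompl K (Submonoid.powers Δ)
    (toLocN act C3 Δ q ≫ toComplN act C3 Δ J J_stable q).hom.toLinearMap := by
  have hann : ∀ r ∈ traceIdeal₃, ∀ v : LocTateMod act C3 Δ q, r • v = 0 := fun r hr v =>
    locTate_smul_eq_zero act C3 Δ q r (tateScalar_of_mem q hr) v
  obtain ⟨m, hm⟩ := Ideal.exists_pow_le_of_le_radical_of_fg J_le_radical
    (Submodule.fg_span (Set.toFinite _))
  let j : TateMod act C3 q →ₗ[inv act ⊤] LocTateMod act C3 Δ q :=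
    LocalizedModule.mkLinearMap (Submonoid.powers Δ) (TateMod act C3 q)
  have hj : IsLocalizedModule (Submonoid.powers Δ) j :=
    inferInstanceAs (IsLocalizedModule (Submonoid.powers Δ)
      (LocalizedModule.mkLinearMap (Submonoid.powers Δ) (TateMod act C3 q)))
  refine IsLocCompl.of_topology J j
    (fun n => ⟨n, fun v hv => ?_⟩) (fun n => ⟨m * n, fun v hv => ?_⟩) _ fun v => rfl
  · have hv := (pow_smul_top_of_tower (K := K) (T := inv act C3) n v).2 hv
    have := Submodule.smul_mono_left (N := (⊤ : Submodule (inv act C3) (LocTateMod act C3 Δ q)))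
      (Ideal.pow_right_mono K_map_le_J n) hv
    rwa [pow_sup_smul_top _ _ hann] at this
  · refine (pow_smul_top_of_tower (K := K) (T := inv act C3) n v).1 ?_
    rw [← pow_sup_smul_top _ _ hann]
    rw [pow_mul] at hv
    exact Submodule.smul_mono_left (Ideal.pow_right_mono hm n) hv

theorem isLocCompl_toE₂loc (p : ℕ) (q : ℤ) :
    IsLocCompl ⊥ (Submonoid.powers Δ) (toE₂loc p q) :=
  isLocCompl_cohMap (finite_N q) _ (IsLocCompl.of_isLocalizedModule
    (LocalizedModule.mkLinearMap (Submonoid.powers Δ) (TateMod act C3 q))) p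

theorem E₂loc_smul_eq_zero (p : ℕ) (q : ℤ) (s : inv act ⊤) (hs : s ∈ traceIdeal)
    (v : E₂loc p q) : s • v = 0 := by
  refine groupCohomology_smul_eq_zero s (fun v : LocTateMod act C3 Δ q => ?_) p v
  have := locTate_smul_eq_zero act C3 Δ q _
    (tateScalar_of_mem q (traceIdeal_map_le (Ideal.mem_map_of_mem _ hs))) v
  rwa [algebraMap_smul] at this

/-- The trace part of `K` annihilates the module, so the `K`-adic and `(s₁, s₂)`-adic filtrations
are equal level by level. -/
theorem isLocCompl_E₂loc (p : ℕ) (q : ℤ) : IsLocCompl K (Submonoid.powers Δ)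
    (AdicCompletion.of (Ideal.span {s₁, s₂}) (E₂loc p q) ∘ₗ toE₂loc p q) := by
  have := (isLocCompl_toE₂loc p q).isLocalizedModule
  have hann := E₂loc_smul_eq_zero p q
  refine IsLocCompl.of_topology _ (toE₂loc p q) (fun n => ⟨n, fun v hv => ?_⟩)
    (fun n => ⟨n, fun v hv => ?_⟩) _ fun v => rfl
  · rwa [K, pow_sup_smul_top _ _ hann] at hv
  · rwa [K, pow_sup_smul_top _ _ hann]

/-- The isomorphism `Ĥ^q(C₃; (Δ⁻¹ M)^∧_I) ≅ (Δ⁻¹ N^q)^∧_J` of representations of `C₉/C₃`. -/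
theorem exists_tateRep_iso (q : ℤ) :
    ∃ e : tateRep C3 (complRingRep act Δ I I_stable) q ≅ complN act C3 Δ J J_stable q,
      tateRepMap C3 q (toComplRing act Δ I I_stable) ≫ e.hom =
        toLocN act C3 Δ q ≫ toComplN act C3 Δ J J_stable q := by
  have hK : K.FG := (isNoetherianRing_iff_ideal_fg _).1 inferInstance K
  obtain ⟨e, he⟩ := (isLocCompl_tateRepMap q).exists_equiv (isLocCompl_toComplN q)
  let f := tateRepMap C3 q (toComplRing act Δ I I_stable)
  let g := toLocN act C3 Δ q ≫ toComplN act C3 Δ J J_stable q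
  have he (v : (N act C3 q).V) : e (f.hom v) = g.hom v := he v
  -- Equivariance: `e ∘ c` and `c ∘ e` are linear maps between completed localizations that agree on
  -- the image of `N^q`, hence everywhere.
  refine ⟨Rep.mkIso (.mk e fun c => (isLocCompl_tateRepMap q).hom_ext hK
    (isLocCompl_toComplN q).isLocalHausdorff fun v => ?_), ?_⟩
  · change e ((tateRep C3 (complRingRep act Δ I I_stable) q).ρ c (f.hom v)) =
      (complN act C3 Δ J J_stable q).ρ c (e (f.hom v))
    rw [he, ← Rep.hom_comm_apply, ← Rep.hom_comm_apply, he]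
  · refine Rep.hom_ext (Representation.IntertwiningMap.ext ?_)
    exact LinearMap.ext he

end SerreCompletion

theorem mainTheorem6 (p : ℕ) (q : ℤ) :
    ∃ (Φ : SerreCompletion.E₂complI p q ≃ₗ[SerreCompletion.inv SerreCompletion.act ⊤]
        SerreCompletion.E₂complJ p q)
      (Ψ : SerreCompletion.E₂complJ p q ≃ₗ[SerreCompletion.inv SerreCompletion.act ⊤]
        AdicCompletion
          (Ideal.span {SerreCompletion.s₁, SerreCompletion.s₂} :
            Ideal (SerreCompletion.inv SerreCompletion.act ⊤))
          (SerreCompletion.E₂loc p q)),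
      (∀ z : SerreCompletion.E₂ p q,
        Φ (SerreCompletion.toComplI p q z) =
          SerreCompletion.toComplJ p q (SerreCompletion.toE₂loc p q z)) ∧
      (∀ z : SerreCompletion.E₂loc p q,
        Ψ (SerreCompletion.toComplJ p q z) = AdicCompletion.of _ _ z) := by
  open SerreCompletion in
  obtain ⟨e, he⟩ := exists_tateRep_iso q
  have hcomp (z : E₂ p q) :
      cohMap (toLocN act C3 Δ q ≫ toComplN act C3 Δ J J_stable q) p z =
        toComplJ p q (toE₂loc p q z) :=
    ConcreteCategory.congr_hom (groupCohomology.map_id_comp (toLocN act C3 Δ q)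
      (toComplN act C3 Δ J J_stable q) p) z
  have hJ := isLocCompl_cohMap (finite_N q) _ (isLocCompl_toComplN q) p
  have hloc := isLocCompl_E₂loc p q
  obtain ⟨Ψ, hΨ⟩ := hJ.exists_equiv hloc
  refine ⟨((groupCohomology.functor _ _ p).mapIso e).toLinearEquiv, Ψ, fun z => ?_, fun z => ?_⟩
  · rw [← hcomp, ← he]
    exact (ConcreteCategory.congr_hom (groupCohomology.map_id_comp
      (tateRepMap C3 q (toComplRing act Δ I I_stable)) e.hom p) z).symm
  · have h : Ψ.toLinearMap ∘ₗ toComplJ p q =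
        AdicCompletion.of (Ideal.span {s₁, s₂}) (E₂loc p q) := by
      -- The equality is known only on `E₂`. As `E₂ → Δ⁻¹ E₂` is a localization, the case `K = ⊥` of
      -- uniqueness extends it: separatedness is then automatic, and only injectivity of `Δ` on the
      -- target is needed.
      refine (isLocCompl_toE₂loc p q).hom_ext (Submodule.fg_bot)
        ⟨inferInstance, hloc.isLocalHausdorff.inj⟩ fun v => ?_
      rw [LinearMap.comp_apply, ← hcomp]
      exact hΨ v
    exact LinearMap.congr_fun h z

end
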